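/- Let $n\ge 14$, let $V_1,V_2,V_3$ be copies of $\mathbb C^n$, and let $X\subset\mathbb P(V_1\otimes V_2\otimes V_3)$ be the Segre variety of classes of nonzero simple tensors. For $T\in V_1\otimes V_2\otimes V_3$, the tangency flattening of $T$ with respect to $A\in\{V_1,V_2,V_3\}$, where $B,C$ denote the other two factors (in their given order), is the linear map $$\textstyle\bigwedge^3A^*\otimes B^*\otimes C^*\to A^*\otimes B\otimes C,\qquad (\alpha_1\wedge\alpha_2\wedge\alpha_3)\otimes\beta\otimes\gamma\mapsto\sum_{\sigma\in S_3}\operatorname{sgn}(\sigma)\,\alpha_{\sigma(1)}\otimes T(\alpha_{\sigma(2)},\cdot,\gamma)\otimes T(\alpha_{\sigma(3)},\beta,\cdot),$$ where $T(\alpha,\cdot,\gamma)\in B$ and $T(\alpha,\beta,\cdot)\in C$ are the contractions of $T$. The entries of its matrix in the standard bases are quadratic forms in the coordinates of $T$, so that its minors are homogeneous polynomials on $V_1\otimes V_2\otimes V_3$. The $n$-th secant variety of $X$ is the Zariski closure of the union of the projective spans of $n$-tuples of points of $X$; the $n$-th cactus variety of $X$ is the Zariski closure of the union of the projective spans of zero-dimensional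 closed subschemes of $X$ of degree $n$. **Theorem.** For each of the three choices of $A$, all minors of size $n(n-1)(n-2)+1$ of the tangency flattening vanish on the $n$-th secant variety of $X$, but not all of them vanish on the $n$-th cactus variety of $X$. -/

import Mathlib

open MvPolynomial

/-! ### Subvarieties of the projective space of lines in `ι → ℂ` -/

/-- The polynomial `f` vanishes on the set `S` of points of the projective space of `ι → ℂ`:
it is zero at every nonzero vector that represents a point of `S`. -/
def VanishesOn {ι : Type} (f : MvPolynomial ι ℂ) (S : Set (Projectivization ℂ (ι → ℂ))) : Prop :=
  ∀ (v : ι → ℂ) (hv : v ≠ 0), Projectivization.mk ℂ v hv ∈ S → eval v f = 0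

/-- The Zariski closure of a set of points of projective space: the common zeros of all
homogeneous polynomials that vanish on the set. -/
def zariskiClosure {ι : Type} (S : Set (Projectivization ℂ (ι → ℂ))) :
    Set (Projectivization ℂ (ι → ℂ)) :=
  {p | ∀ (d : ℕ) (f : MvPolynomial ι ℂ), f.IsHomogeneous d → VanishesOn f S → VanishesOn f {p}}

/-- The `k`-th secant variety of `X`: the Zariski closure of the union of the projective spans
of `k`-tuples of points of `X`. -/
def secantVariety {ι : Type} (k : ℕ) (X : Set (Projectivization ℂ (ι → ℂ))) :
    Set (Projectivization ℂ (ι → ℂ)) :=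
  zariskiClosure {p | ∃ x : Fin k → Projectivization ℂ (ι → ℂ),
    (∀ j, x j ∈ X) ∧ p.submodule ≤ ⨆ j, (x j).submodule}

/-- `I` is the saturated homogeneous ideal of a zero-dimensional closed subscheme of degree `k`
of the (reduced) projective variety `X`. Closed subschemes of projective space are identified
with saturated homogeneous ideals of the homogeneous coordinate ring; such a subscheme is
contained in `X` when its ideal contains all polynomials that vanish on `X`, and it is
zero-dimensional of degree `k` (or empty, if `k = 0`) when its Hilbert polynomial is the
constant `k`. -/
structure IsZeroDimSubscheme {ι : Type} (k : ℕ) (X : Set (Projectivization ℂ (ι → ℂ)))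
    (I : Ideal (MvPolynomial ι ℂ)) : Prop where
  /-- The ideal is homogeneous. -/
  homogeneous : ∀ f ∈ I, ∀ d, homogeneousComponent d f ∈ I
  /-- The ideal is saturated with respect to the ideal generated by the variables. -/
  saturated : ∀ f : MvPolynomial ι ℂ, (∀ i, MvPolynomial.X i * f ∈ I) → f ∈ I
  /-- The subscheme is contained in `X`. -/
  subset : ∀ f : MvPolynomial ι ℂ, VanishesOn f X → f ∈ I
  /-- The degree `d` part of the quotient by `I` has dimension `k` for all large `d`. -/
  degree : ∀ᶠ d in Filter.atTop,
    Module.finrank ℂ ((homogeneousSubmodule ι ℂ d).map (Ideal.Quotient.mkₐ ℂ I).toLinearMap) = k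

/-- The projective span of the subscheme with saturated ideal `I`: the smallest projective
linear subspace that contains the subscheme, cut out by the linear forms in `I`. -/
def projectiveSpan {ι : Type} (I : Ideal (MvPolynomial ι ℂ)) :
    Set (Projectivization ℂ (ι → ℂ)) :=
  {p | ∀ f ∈ I, f.IsHomogeneous 1 → VanishesOn f {p}}

/-- The `k`-th cactus variety of `X`: the Zariski closure of the union of the projective spans
of zero-dimensional subschemes of degree `k` of `X`. -/
def cactusVariety {ι : Type} (k : ℕ) (X : Set (Projectivization ℂ (ι → ℂ))) :
    Set (Projectivization ℂ (ι → ℂ)) :=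
  zariskiClosure {p | ∃ I : Ideal (MvPolynomial ι ℂ), IsZeroDimSubscheme k X I ∧
    p ∈ projectiveSpan I}

/-! ### Tensors in `ℂⁿ ⊗ ℂⁿ ⊗ ℂⁿ` and their tangency flattenings -/

/-- The index set of the standard basis `e_a ⊗ e_b ⊗ e_c` of `ℂⁿ ⊗ ℂⁿ ⊗ ℂⁿ`. A tensor is given
by its coordinates, that is, by a function on this set. -/
abbrev TensorIndex (n : ℕ) : Type := Fin n × Fin n × Fin n

/-- The Segre variety in the projective space of `ℂⁿ ⊗ ℂⁿ ⊗ ℂⁿ`: the classes of the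
simple tensors `u ⊗ v ⊗ w ≠ 0`. -/
def segreVariety (n : ℕ) : Set (Projectivization ℂ (TensorIndex n → ℂ)) :=
  {p | ∃ (u v w : Fin n → ℂ) (h : (fun x : TensorIndex n => u x.1 * v x.2.1 * w x.2.2) ≠ 0),
    p = Projectivization.mk ℂ _ h}

/-- The tensor with its factor number `i` (counted from `0`) moved to the first place, the two
other factors being kept in their order. -/
def moveToFront {n : ℕ} {R : Type} (i : Fin 3) (T : TensorIndex n → R) : TensorIndex n → R :=
  match i with
  | 0 => T
  | 1 => fun x => T (x.2.1, x.1, x.2.2)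
  | 2 => fun x => T (x.2.1, x.2.2, x.1)

/-- The index set of the basis `(e*_{s 0} ∧ e*_{s 1} ∧ e*_{s 2}) ⊗ e*_b ⊗ e*_c`, with
`s 0 < s 1 < s 2`, of `⋀³ (ℂⁿ)* ⊗ (ℂⁿ)* ⊗ (ℂⁿ)*`. -/
abbrev WedgeIndex (n : ℕ) : Type := (Fin 3 ↪o Fin n) × Fin n × Fin n

/-- The matrix, in the standard bases, of the tangency flattening
`⋀³ A* ⊗ B* ⊗ C* → A* ⊗ B ⊗ C` of a tensor `T ∈ A ⊗ B ⊗ C`, which is the linear map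
`(α₀ ∧ α₁ ∧ α₂) ⊗ β ⊗ γ ↦ ∑_σ sgn(σ) α_{σ 0} ⊗ T(α_{σ 1}, ·, γ) ⊗ T(α_{σ 2}, β, ·)`,
the sum being over the permutations of three letters. Columns are indexed by the basis of the
domain, rows by that of the codomain. -/
def tangencyMatrix {n : ℕ} {R : Type} [CommRing R] (T : TensorIndex n → R) :
    Matrix (TensorIndex n) (WedgeIndex n) R :=
  Matrix.of fun (a, b, c) (s, b', c') =>
    ∑ σ : Equiv.Perm (Fin 3), ((Equiv.Perm.sign σ : ℤ) : R) *
      ((if a = s (σ 0) then 1 else 0) * T (s (σ 1), b, c') * T (s (σ 2), b', c))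

/-- The tangency flattening of `T ∈ V₀ ⊗ V₁ ⊗ V₂` (each `Vⱼ = ℂⁿ`) with respect to the factor
`Vᵢ`, as a matrix in the standard bases; the factor `Vᵢ` plays the role of `A`. -/
def tangencyFlattening {n : ℕ} {R : Type} [CommRing R] (i : Fin 3) (T : TensorIndex n → R) :
    Matrix (TensorIndex n) (WedgeIndex n) R :=
  tangencyMatrix (moveToFront i T)

/-- The minor with rows `r` and columns `c` of the tangency flattening with respect to the factor
`i`, as a polynomial in the `n³` coordinates of a tensor. -/
noncomputable def tangencyMinor {n m : ℕ} (i : Fin 3) (r : Fin m ↪ TensorIndex n)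
    (c : Fin m ↪ WedgeIndex n) : MvPolynomial (TensorIndex n) ℂ :=
  ((tangencyFlattening i fun x : TensorIndex n => (X x : MvPolynomial (TensorIndex n) ℂ)).submatrix
    r c).det

/-! ### Minors and ranks -/

/-! On a sum of `n` simple tensors `u_p ⊗ v_p ⊗ w_p` the flattening is a sum over ordered pairs `(p,
q)`. The term of a pair factors through the contraction of `⋀³ A*` with `u_p ∧ u_q`, which is zero
for `p = q` and has rank at most `n - 2` otherwise. So the rank is at most `n (n - 1) (n - 2)`
(`rank_tangencyMatrix_le`), and homogeneity of the minors carries their vanishing over to the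
closure.

For the cactus variety, let `R` be a commutative algebra of dimension `n` with a functional `φ` such
that `φ (x y)` is nondegenerate. A basis of `R`, used in all three factors, embeds `Spec R` in the
Segre variety, and the span of the image contains the tensor `φ (x y z)`
(`mk_traceTensor_mem_cactusVariety`). Since `φ` identifies `R` with its dual, the left kernel of the
flattening embeds in the space `K = alternantAnnihilator R` (`pow_three_le_rank_add_finrank`). It
therefore suffices that `dim K` is less than `n³ - n (n - 1) (n - 2) = 3 n² - 2 n`. By the bound on
the secant variety, no smoothable `R` can achieve this.

Passing from `R` to `R × ℂ` raises `dim K` by at most `6 n + 1`, exactly the increment of `3 n² - 2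
n`, so one algebra of dimension 14 is enough. It is the apolar algebra of a cubic in six variables,
with Hilbert function `(1, 6, 6, 1)`. After the values with an argument `1` are split off (`196 +
182 + 91` of them), a form in `K` becomes symmetric on the maximal ideal, subject to homogeneous
relations. It is determined by 56 values in degree three, 27 in degree four and 6 in degree five,
and it vanishes from degree six on; hence `dim K ≤ 558 < 560`. The cubic is sparse enough that each
relation in degrees four and five has at most four terms, and the unknowns can be eliminated one at
a time by a finite computation (`quartic_propagates`, `quintic_propagates`). -/

theorem Matrix.det_submatrix_eq_zero_of_rank_lt {K : Type} [Field K] {m n : Type} [Fintype m]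
    [Fintype n] (A : Matrix m n K) {k : ℕ} (h : A.rank < k) (r : Fin k → m) (c : Fin k → n) :
    (A.submatrix r c).det = 0 := by
  by_contra hd
  have h1 : (A.submatrix r c).rank = k := by
    rw [Matrix.rank_of_det_ne_zero hd, Fintype.card_fin]
  have h2 := Matrix.eRank_submatrix_le A r c
  have h3 : A.eRank ≠ ⊤ := by
    refine ne_top_of_le_ne_top ?_ A.eRank_le_card_width
    simp
  have h4 := ENat.toNat_le_toNat h2 h3
  rw [Matrix.eRank_toNat_eq_rank, Matrix.eRank_toNat_eq_rank] at h4
  omega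

theorem Matrix.exists_linearIndependent_col {K : Type} [Field K] {m n : Type} [Fintype m]
    [Fintype n] (A : Matrix m n K) {k : ℕ} (h : k ≤ A.rank) :
    ∃ c : Fin k ↪ n, LinearIndependent K (fun j => A.col (c j)) := by
  obtain ⟨κ, a, ha, hsp, hli⟩ := exists_linearIndependent' K A.col
  have : Fintype κ := Fintype.ofInjective a ha
  rw [Matrix.rank_eq_finrank_span_cols, ← hsp, finrank_span_eq_card hli] at h
  obtain ⟨f⟩ : Nonempty (Fin k ↪ κ) := by
    rw [Function.Embedding.nonempty_iff_card_le]; simpa using h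
  exact ⟨f.trans ⟨a, ha⟩, hli.comp f f.injective⟩

theorem Matrix.exists_det_submatrix_ne_zero {K : Type} [Field K] {m n : Type} [Fintype m]
    [Fintype n] (A : Matrix m n K) {k : ℕ} (h : k ≤ A.rank) :
    ∃ (r : Fin k ↪ m) (c : Fin k ↪ n), (A.submatrix r c).det ≠ 0 := by
  obtain ⟨c, hc⟩ := A.exists_linearIndependent_col h
  have h1 : k ≤ (A.submatrix id c).transpose.rank := by
    have : LinearIndependent K (A.submatrix id c).transpose.row := hc
    rw [this.rank_matrix, Fintype.card_fin]
  obtain ⟨r, hr⟩ := Matrix.exists_linearIndependent_col _ h1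
  refine ⟨r, c, ?_⟩
  have h2 : LinearIndependent K (A.submatrix r c).row := hr
  rw [Matrix.linearIndependent_rows_iff_isUnit, Matrix.isUnit_iff_isUnit_det] at h2
  exact h2.ne_zero

/-! ### The minors of the tangency flattening as polynomials -/

theorem map_tangencyFlattening {n : ℕ} {R S : Type} [CommRing R] [CommRing S] (f : R →+* S)
    (i : Fin 3) (T : TensorIndex n → R) :
    (tangencyFlattening i T).map f = tangencyFlattening i (fun x => f (T x)) := by
  ext ⟨a, b, c⟩ ⟨s, b', c'⟩
  fin_cases i <;>
    simp [tangencyFlattening, tangencyMatrix, moveToFront, apply_ite f]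

theorem eval_tangencyMinor {n m : ℕ} (i : Fin 3) (r : Fin m ↪ TensorIndex n)
    (c : Fin m ↪ WedgeIndex n) (v : TensorIndex n → ℂ) :
    eval v (tangencyMinor i r c) = ((tangencyFlattening i v).submatrix r c).det := by
  rw [tangencyMinor, RingHom.map_det, RingHom.mapMatrix_apply, ← Matrix.submatrix_map,
    map_tangencyFlattening]
  simp

theorem isHomogeneous_tangencyMinor {n m : ℕ} (i : Fin 3) (r : Fin m ↪ TensorIndex n)
    (c : Fin m ↪ WedgeIndex n) : (tangencyMinor i r c).IsHomogeneous (m * 2) := by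
  have hX : ∀ x, (moveToFront i (fun x : TensorIndex n =>
      (X x : MvPolynomial (TensorIndex n) ℂ)) x).IsHomogeneous 1 := by
    intro x
    fin_cases i <;> exact isHomogeneous_X ℂ _
  have hent : ∀ x y, (tangencyFlattening i (fun x : TensorIndex n =>
      (X x : MvPolynomial (TensorIndex n) ℂ)) x y).IsHomogeneous 2 := by
    rintro ⟨a, b, c⟩ ⟨s, b', c'⟩
    rw [tangencyFlattening, tangencyMatrix, Matrix.of_apply]
    refine IsHomogeneous.sum _ _ _ fun σ _ => ?_
    have h0 : ((((Equiv.Perm.sign σ : ℤ) : MvPolynomial (TensorIndex n) ℂ)) *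
        (if a = s (σ 0) then 1 else 0)).IsHomogeneous 0 := by
      rw [show ((((Equiv.Perm.sign σ : ℤ) : MvPolynomial (TensorIndex n) ℂ)) *
        (if a = s (σ 0) then 1 else 0)) =
        C (((Equiv.Perm.sign σ : ℤ) : ℂ) * (if a = s (σ 0) then 1 else 0)) by
          split_ifs <;> simp]
      exact isHomogeneous_C _ _
    have := (h0.mul (hX (s (σ 1), b, c'))).mul (hX (s (σ 2), b', c))
    simpa only [mul_assoc] using this
  rw [tangencyMinor, Matrix.det_apply]
  refine IsHomogeneous.sum _ _ _ fun σ _ => ?_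
  have h1 := IsHomogeneous.prod Finset.univ (fun j => (tangencyFlattening i
    (fun x : TensorIndex n => (X x : MvPolynomial (TensorIndex n) ℂ))).submatrix r c (σ j) j)
    (fun _ => 2) (fun j _ => hent _ _)
  rw [Finset.sum_const, Finset.card_univ, Fintype.card_fin, smul_eq_mul] at h1
  rw [Units.smul_def, ← Int.cast_smul_eq_zsmul ℂ]
  exact (homogeneousSubmodule _ _ _).smul_mem _ h1

/-! ### The rank on the secant variety -/

/-- The matrix of the contraction `⋀³ A* → A*` with the bivector `u ∧ v`. -/
def wedgeContraction {n : ℕ} (u v : Fin n → ℂ) : Matrix (Fin n) (Fin 3 ↪o Fin n) ℂ :=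
  Matrix.of fun a s => ∑ σ : Equiv.Perm (Fin 3), ((Equiv.Perm.sign σ : ℤ) : ℂ) *
    ((if a = s (σ 0) then 1 else 0) * u (s (σ 1)) * v (s (σ 2)))

theorem wedgeContraction_apply {n : ℕ} (u v : Fin n → ℂ) (a : Fin n) (s : Fin 3 ↪o Fin n) :
    wedgeContraction u v a s =
      (if a = s 0 then 1 else 0) * (u (s 1) * v (s 2) - u (s 2) * v (s 1)) +
      (if a = s 1 then 1 else 0) * (u (s 2) * v (s 0) - u (s 0) * v (s 2)) +
      (if a = s 2 then 1 else 0) * (u (s 0) * v (s 1) - u (s 1) * v (s 0)) := by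
  -- The sum over permutations is a determinant whose rows are the indicator of `a`, `u` and `v`,
  -- expanded along the first row.
  have := Matrix.det_fin_three (Matrix.of ![fun j => if a = s j then (1 : ℂ) else 0,
    fun j => u (s j), fun j => v (s j)])
  rw [← Matrix.det_transpose, Matrix.det_apply] at this
  simp only [Fin.prod_univ_three, Matrix.transpose_apply, Matrix.of_apply, Matrix.cons_val_zero,
    Matrix.cons_val_one, Matrix.cons_val, Units.smul_def, ← Int.cast_smul_eq_zsmul ℂ,
    smul_eq_mul] at this
  rw [wedgeContraction, Matrix.of_apply, this]
  ring

/-- The image consists of covectors that kill `u` and `v`, since pairing with either one produces a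
wedge with a repeated factor. This has codimension two if `u`, `v` are independent; otherwise `u ∧ v
= 0`. -/
theorem rank_wedgeContraction_le {n : ℕ} (u v : Fin n → ℂ) :
    (wedgeContraction u v).rank ≤ n - 2 := by
  by_cases h : LinearIndependent ℂ ![u, v]
  · have h0 : Matrix.of ![u, v] * wedgeContraction u v = 0 := by
      ext j s
      simp only [Matrix.mul_apply, wedgeContraction_apply, mul_add, Finset.sum_add_distrib,
        ite_mul, mul_ite, one_mul, zero_mul, mul_zero, Finset.sum_ite_eq', Finset.mem_univ,
        if_true, Matrix.of_apply, Matrix.zero_apply]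
      fin_cases j <;> simp <;> ring
    have h1 := Matrix.rank_add_rank_le_card_of_mul_eq_zero h0
    have h2 : LinearIndependent ℂ (Matrix.of ![u, v]).row := h
    rw [h2.rank_matrix, Fintype.card_fin, Fintype.card_fin] at h1
    omega
  · have h0 : wedgeContraction u v = 0 := by
      have : ∀ p q, u p * v q - u q * v p = 0 := by
        rw [LinearIndependent.pair_iff] at h
        push Not at h
        obtain ⟨x, y, hxy, hne⟩ := h
        intro p q
        have hp := congrFun hxy p
        have hq := congrFun hxy q
        simp only [Pi.add_apply, Pi.smul_apply, smul_eq_mul, Pi.zero_apply] at hp hq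
        by_cases hx : x = 0
        · have hy := hne hx
          subst hx
          have hp' : v p = 0 := by simpa [hy] using hp
          have hq' : v q = 0 := by simpa [hy] using hq
          simp [hp', hq']
        · apply mul_left_cancel₀ hx
          linear_combination v q * hp - v p * hq
      ext a s
      rw [wedgeContraction_apply]
      simp [this]
    simp [h0]

theorem wedgeContraction_self {n : ℕ} (u : Fin n → ℂ) : wedgeContraction u u = 0 := by
  ext a s
  rw [wedgeContraction_apply, Matrix.zero_apply]
  ring

theorem Matrix.rank_add_le {K : Type} [Field K] {m n : Type} [Fintype m] [Fintype n]
    (A B : Matrix m n K) : (A + B).rank ≤ A.rank + B.rank := by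
  rw [Matrix.rank, Matrix.rank, Matrix.rank, Matrix.mulVecLin_add]
  refine le_trans (Submodule.finrank_mono ?_) (Submodule.finrank_add_le_finrank_add_finrank _ _)
  rintro _ ⟨x, rfl⟩
  exact Submodule.add_mem_sup ⟨x, rfl⟩ ⟨x, rfl⟩

theorem Matrix.rank_sum_le {K : Type} [Field K] {m n ι : Type} [Fintype m] [Fintype n]
    (s : Finset ι) (A : ι → Matrix m n K) : (∑ i ∈ s, A i).rank ≤ ∑ i ∈ s, (A i).rank := by
  classical
  induction s using Finset.induction_on with
  | empty => simp
  | insert a s ha ih =>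
    rw [Finset.sum_insert ha, Finset.sum_insert ha]
    exact (Matrix.rank_add_le _ _).trans (by gcongr)

/-- The tangency flattening of a sum of simple tensors, as a sum over pairs of summands. -/
theorem tangencyMatrix_sum {n k : ℕ} (u v w : Fin k → Fin n → ℂ) :
    tangencyMatrix (fun x => ∑ j, u j x.1 * v j x.2.1 * w j x.2.2) =
      ∑ p : Fin k × Fin k,
        (Matrix.of fun (x : TensorIndex n) (a : Fin n) =>
          if x.1 = a then v p.1 x.2.1 * w p.2 x.2.2 else 0) *
        wedgeContraction (u p.1) (u p.2) *
        (Matrix.of fun (s : Fin 3 ↪o Fin n) (y : WedgeIndex n) =>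
          if y.1 = s then w p.1 y.2.2 * v p.2 y.2.1 else 0) := by
  ext ⟨a, b, c⟩ ⟨s, b', c'⟩
  simp only [tangencyMatrix, Matrix.of_apply, Matrix.sum_apply, Matrix.mul_apply, ite_mul,
    zero_mul, mul_ite, mul_zero, Finset.sum_ite_eq, Finset.mem_univ, if_true, wedgeContraction]
  simp_rw [mul_assoc, Finset.sum_mul_sum, ← Fintype.sum_prod_type', Finset.mul_sum,
    Finset.sum_mul, Finset.mul_sum]
  rw [Finset.sum_comm]
  refine Finset.sum_congr rfl fun σ _ => ?_
  split_ifs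
  · exact Finset.sum_congr rfl fun p _ => by ring
  · simp

theorem rank_tangencyMatrix_le {n : ℕ} (u v w : Fin n → Fin n → ℂ) :
    (tangencyMatrix (fun x => ∑ j, u j x.1 * v j x.2.1 * w j x.2.2)).rank ≤
      n * (n - 1) * (n - 2) := by
  rw [tangencyMatrix_sum]
  refine (Matrix.rank_sum_le _ _).trans ?_
  calc _ ≤ ∑ p : Fin n × Fin n, if p.1 = p.2 then 0 else n - 2 := by
        refine Finset.sum_le_sum fun p _ => ?_
        refine ((Matrix.rank_mul_le_left _ _).trans (Matrix.rank_mul_le_right _ _)).trans ?_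
        split_ifs with h
        · rw [h, wedgeContraction_self, Matrix.rank_zero]
        · exact rank_wedgeContraction_le _ _
    _ = n * (n - 1) * (n - 2) := by
        rw [Fintype.sum_prod_type]
        have : ∀ j : Fin n, (∑ k : Fin n, if j = k then 0 else n - 2) = (n - 1) * (n - 2) := by
          intro j
          rw [Finset.sum_ite, Finset.sum_const_zero, zero_add, Finset.sum_const, smul_eq_mul,
            Finset.filter_ne, Finset.card_erase_of_mem (Finset.mem_univ _), Finset.card_univ,
            Fintype.card_fin]
        rw [Finset.sum_congr rfl fun j _ => this j, Finset.sum_const, smul_eq_mul,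
          Finset.card_univ, Fintype.card_fin, mul_assoc]

theorem rank_tangencyFlattening_le {n : ℕ} (i : Fin 3) (u v w : Fin n → Fin n → ℂ) :
    (tangencyFlattening i (fun x => ∑ j, u j x.1 * v j x.2.1 * w j x.2.2)).rank ≤
      n * (n - 1) * (n - 2) := by
  fin_cases i
  · exact rank_tangencyMatrix_le u v w
  · convert rank_tangencyMatrix_le v u w using 2
    refine congrArg tangencyMatrix (_root_.funext fun x => Finset.sum_congr rfl fun j _ => ?_)
    ring
  · convert rank_tangencyMatrix_le w u v using 2
    refine congrArg tangencyMatrix (_root_.funext fun x => Finset.sum_congr rfl fun j _ => ?_)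
    ring

/-- A homogeneous polynomial that vanishes on a set vanishes on its Zariski closure. -/
theorem VanishesOn.zariskiClosure {ι : Type} {f : MvPolynomial ι ℂ} {d : ℕ}
    (hf : f.IsHomogeneous d) {S : Set (Projectivization ℂ (ι → ℂ))} (h : VanishesOn f S) :
    VanishesOn f (zariskiClosure S) :=
  fun v hv hvS => hvS d f hf h v hv rfl

theorem subset_zariskiClosure {ι : Type} (S : Set (Projectivization ℂ (ι → ℂ))) :
    S ⊆ zariskiClosure S := by
  intro p hp d f _ hfS v hv hvp
  rw [Set.mem_singleton_iff] at hvp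
  exact hfS v hv (hvp ▸ hp)

theorem vanishesOn_secantVariety {n : ℕ} (i : Fin 3)
    (r : Fin (n * (n - 1) * (n - 2) + 1) ↪ TensorIndex n)
    (c : Fin (n * (n - 1) * (n - 2) + 1) ↪ WedgeIndex n) :
    VanishesOn (tangencyMinor i r c) (secantVariety n (segreVariety n)) := by
  refine VanishesOn.zariskiClosure (isHomogeneous_tangencyMinor i r c) ?_
  rintro T hT ⟨x, hx, hTx⟩
  choose u v w hne hx using hx
  have hmem : T ∈ Submodule.span ℂ
      (Set.range fun j => fun y : TensorIndex n => u j y.1 * v j y.2.1 * w j y.2.2) := by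
    have h1 : T ∈ (Projectivization.mk ℂ T hT).submodule := by
      rw [Projectivization.submodule_mk]
      exact Submodule.mem_span_singleton_self T
    have h2 := hTx h1
    simp_rw [hx, Projectivization.submodule_mk] at h2
    rwa [← Submodule.span_range_eq_iSup] at h2
  obtain ⟨t, ht⟩ := (Submodule.mem_span_range_iff_exists_fun ℂ).1 hmem
  -- The scalars of the linear combination are absorbed into the first factors.
  have hT' : T = fun y => ∑ j, (t j • u j) y.1 * v j y.2.1 * w j y.2.2 := by
    rw [← ht]
    ext y
    simp [Finset.sum_apply, mul_assoc]
  rw [eval_tangencyMinor, hT']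
  exact Matrix.det_submatrix_eq_zero_of_rank_lt _
    (Nat.lt_succ_of_le (rank_tangencyFlattening_le i _ v w)) r c

/-! ### The spectrum of a finite algebra as a subscheme of the Segre variety -/

section Scheme

variable {R : Type} [CommRing R] [Algebra ℂ R] {n : ℕ}

/-- The value of the coordinate functions on the `R`-valued point of the Segre variety
given by a basis of `R`, used in each of the three factors. -/
noncomputable def basisProduct (b : Module.Basis (Fin n) ℂ R) (x : TensorIndex n) : R :=
  b x.1 * b x.2.1 * b x.2.2

/-- The homomorphism of graded rings `ℂ[z] → R[t]` whose kernel is the saturated ideal of the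
image of `Spec R` in the Segre variety. -/
noncomputable def coneHom (b : Module.Basis (Fin n) ℂ R) :
    MvPolynomial (TensorIndex n) ℂ →ₐ[ℂ] Polynomial R :=
  aeval fun x => Polynomial.monomial 1 (basisProduct b x)

theorem coneHom_eq_of_isHomogeneous (b : Module.Basis (Fin n) ℂ R) {d : ℕ}
    {f : MvPolynomial (TensorIndex n) ℂ} (hf : f.IsHomogeneous d) :
    coneHom b f = Polynomial.monomial d (MvPolynomial.aeval (basisProduct b) f) := by
  rw [coneHom, aeval_def, aeval_def, eval₂_eq', eval₂_eq', map_sum]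
  refine Finset.sum_congr rfl fun m hm => ?_
  have hd : ∑ x, m x = d := by
    rw [← Finsupp.degree_eq_sum]
    by_contra h
    exact mem_support_iff.1 hm (hf.coeff_eq_zero h)
  simp only [← Polynomial.C_mul_X_pow_eq_monomial, pow_one, mul_pow, Finset.prod_mul_distrib,
    Finset.prod_pow_eq_pow_sum, hd, map_mul, map_prod, map_pow]
  rw [mul_assoc]
  rfl

theorem coeff_coneHom (b : Module.Basis (Fin n) ℂ R) (f : MvPolynomial (TensorIndex n) ℂ)
    (d : ℕ) : (coneHom b f).coeff d = aeval (basisProduct b) (homogeneousComponent d f) := by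
  conv_lhs => rw [← sum_homogeneousComponent f]
  simp only [map_sum, coneHom_eq_of_isHomogeneous b (homogeneousComponent_isHomogeneous _ f),
    Polynomial.finsetSum_coeff, Polynomial.coeff_monomial]
  rw [Finset.sum_ite_eq']
  split_ifs with h
  · rfl
  · rw [homogeneousComponent_eq_zero, map_zero]
    simpa using h

theorem mem_ker_coneHom (b : Module.Basis (Fin n) ℂ R) (f : MvPolynomial (TensorIndex n) ℂ) :
    f ∈ RingHom.ker (coneHom b) ↔ ∀ d, aeval (basisProduct b) (homogeneousComponent d f) = 0 := by
  simp_rw [RingHom.mem_ker, Polynomial.ext_iff, coeff_coneHom, Polynomial.coeff_zero]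

/-- Expand `1 * 1 * r` in the basis. The form with value `1` serves to shift degrees, both for the
Hilbert function and for saturation. -/
theorem exists_linear_aeval_basisProduct (b : Module.Basis (Fin n) ℂ R) (r : R) :
    ∃ f : MvPolynomial (TensorIndex n) ℂ, f.IsHomogeneous 1 ∧ aeval (basisProduct b) f = r := by
  refine ⟨∑ x : TensorIndex n,
    C (b.repr r x.1 * b.repr 1 x.2.1 * b.repr 1 x.2.2) * X x, ?_, ?_⟩
  · exact IsHomogeneous.sum _ _ _ fun x _ => isHomogeneous_C_mul_X _ _
  · calc _ = (∑ i, b.repr 1 i • b i) * (∑ i, b.repr 1 i • b i) * ∑ i, b.repr r i • b i := by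
          simp only [map_sum, map_mul, aeval_C, aeval_X, Fintype.sum_prod_type, Finset.sum_mul,
            Finset.mul_sum, basisProduct, Algebra.smul_def]
          exact Finset.sum_congr rfl fun i _ => Finset.sum_congr rfl fun j _ =>
            Finset.sum_congr rfl fun k _ => by ring
      _ = r := by rw [b.sum_repr, b.sum_repr, one_mul, one_mul]

theorem map_coneHom_homogeneousSubmodule (b : Module.Basis (Fin n) ℂ R) {d : ℕ} (hd : 0 < d) :
    (homogeneousSubmodule (TensorIndex n) ℂ d).map (coneHom b).toLinearMap =
      LinearMap.range ((Polynomial.monomial d : R →ₗ[R] Polynomial R).restrictScalars ℂ) := by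
  ext p
  constructor
  · rintro ⟨f, hf, rfl⟩
    exact ⟨_, (coneHom_eq_of_isHomogeneous b hf).symm⟩
  · rintro ⟨r, rfl⟩
    obtain ⟨f, hf, hfr⟩ := exists_linear_aeval_basisProduct b r
    obtain ⟨g, hg, hg1⟩ := exists_linear_aeval_basisProduct b 1
    have hfg : (f * g ^ (d - 1)).IsHomogeneous d := by
      convert hf.mul (hg.pow (d - 1)) using 1
      omega
    refine ⟨_, hfg, ?_⟩
    change coneHom b _ = _
    rw [coneHom_eq_of_isHomogeneous b hfg, map_mul, map_pow, hg1, hfr, one_pow, mul_one]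
    rfl

/-- A polynomial over an infinite field that is zero at all points is zero. The pullback is only
known to vanish where `u ⊗ v ⊗ w ≠ 0`; multiplying it by the coordinate `(k, k, k)` of that tensor
covers the other points. -/
theorem aeval_eq_zero_of_vanishesOn_segreVariety {f : MvPolynomial (TensorIndex n) ℂ}
    (hf : VanishesOn f (segreVariety n)) (k : Fin n) :
    aeval (fun x : TensorIndex n => (X (0, x.1) * X (1, x.2.1) * X (2, x.2.2) :
      MvPolynomial (Fin 3 × Fin n) ℂ)) f = 0 := by
  have hX : (X (0, k) * X (1, k) * X (2, k) : MvPolynomial (Fin 3 × Fin n) ℂ) ≠ 0 :=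
    mul_ne_zero (mul_ne_zero (X_ne_zero _) (X_ne_zero _)) (X_ne_zero _)
  refine (mul_eq_zero.1 (MvPolynomial.funext (q := 0) fun v => ?_)).resolve_right hX
  rw [map_mul, map_zero, mul_eq_zero, or_iff_not_imp_right]
  intro hv
  have hne : (fun x : TensorIndex n => v (0, x.1) * v (1, x.2.1) * v (2, x.2.2)) ≠ 0 := by
    intro h
    apply hv
    simpa using congrFun h (k, k, k)
  have := hf _ hne ⟨fun a => v (0, a), fun a => v (1, a), fun a => v (2, a), hne, rfl⟩
  rw [← this, ← aeval_eq_eval, ← AlgHom.comp_apply, comp_aeval]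
  simp [aeval_eq_eval]

theorem mem_ker_coneHom_of_vanishesOn (b : Module.Basis (Fin n) ℂ R) (k : Fin n)
    {f : MvPolynomial (TensorIndex n) ℂ} (hf : VanishesOn f (segreVariety n)) :
    f ∈ RingHom.ker (coneHom b) := by
  -- The generic point is specialised to the basis of `R`, with `t` in the first factor only, so
  -- that each coordinate has degree one in `t`.
  have h := congrArg (aeval (fun y : Fin 3 × Fin n =>
    Polynomial.monomial (if y.1 = 0 then 1 else 0) (b y.2)))
    (aeval_eq_zero_of_vanishesOn_segreVariety hf k)
  rw [map_zero, ← AlgHom.comp_apply, comp_aeval] at h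
  rw [RingHom.mem_ker, ← h, coneHom]
  congr 2
  ext1 x
  simp [basisProduct]

theorem isZeroDimSubscheme_ker_coneHom (b : Module.Basis (Fin n) ℂ R) (k : Fin n) :
    IsZeroDimSubscheme n (segreVariety n) (RingHom.ker (coneHom b)) where
  homogeneous f hf d := by
    rw [mem_ker_coneHom] at hf ⊢
    intro e
    rw [homogeneousComponent_of_mem (homogeneousComponent_mem d f)]
    split_ifs with h
    · exact hf d
    · exact map_zero _
  saturated f hf := by
    -- Multiplication by `g` becomes multiplication by `t` in `R[t]`, which is injective.
    obtain ⟨g, hg, hg1⟩ := exists_linear_aeval_basisProduct b 1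
    have hspan : ∀ g ∈ Submodule.span ℂ (Set.range X), g * f ∈ RingHom.ker (coneHom b) := by
      intro g hg
      induction hg using Submodule.span_induction with
      | mem x hx =>
        obtain ⟨i, rfl⟩ := hx
        exact hf i
      | zero => simp
      | add x y _ _ hx hy => rw [add_mul]; exact Ideal.add_mem _ hx hy
      | smul a x _ hx =>
        rw [smul_eq_C_mul, mul_assoc]
        exact Ideal.mul_mem_left _ _ hx
    have h : g * f ∈ RingHom.ker (coneHom b) :=
      hspan g (by rw [← homogeneousSubmodule_one_eq_span_X]; exact hg)
    rw [RingHom.mem_ker, map_mul, coneHom_eq_of_isHomogeneous b hg, hg1] at h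
    rw [RingHom.mem_ker]
    ext d
    have := congrArg (fun p => Polynomial.coeff p (d + 1)) h
    simpa [Polynomial.coeff_monomial_mul] using this
  subset f hf := mem_ker_coneHom_of_vanishesOn b k hf
  degree := by
    -- In positive degree the graded piece of the quotient is `R t ^ d`; in degree zero it is only
    -- `ℂ`.
    filter_upwards [Filter.eventually_gt_atTop 0] with d hd
    have hinj := Ideal.kerLiftAlg_injective (coneHom b)
    have h1 := (Submodule.equivMapOfInjective (Ideal.kerLiftAlg (coneHom b)).toLinearMap hinj
      ((homogeneousSubmodule (TensorIndex n) ℂ d).map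
        (Ideal.Quotient.mkₐ ℂ (RingHom.ker (coneHom b))).toLinearMap)).finrank_eq
    rw [h1, ← Submodule.map_comp]
    have h2 : (Ideal.kerLiftAlg (coneHom b)).toLinearMap ∘ₗ
        (Ideal.Quotient.mkₐ ℂ (RingHom.ker (coneHom b))).toLinearMap =
        (coneHom b).toLinearMap := by
      ext x
      rfl
    rw [h2, map_coneHom_homogeneousSubmodule b hd]
    refine (LinearMap.finrank_range_of_inj (f := (Polynomial.monomial d : R →ₗ[R]
      Polynomial R).restrictScalars ℂ) (Polynomial.monomial_injective d)).trans ?_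
    rw [Module.finrank_eq_card_basis b, Fintype.card_fin]

/-- The trilinear form `(x, y, z) ↦ φ (x * y * z)` in coordinates. -/
noncomputable def traceTensor (b : Module.Basis (Fin n) ℂ R) (φ : R →ₗ[ℂ] ℂ) :
    TensorIndex n → ℂ :=
  fun x => φ (basisProduct b x)

/-- A linear form in the ideal is a linear relation between the products of three basis elements,
and `φ` turns it into the vanishing of that form at the trace tensor. -/
theorem mk_traceTensor_mem_cactusVariety (b : Module.Basis (Fin n) ℂ R) (k : Fin n)
    (φ : R →ₗ[ℂ] ℂ) (h : traceTensor b φ ≠ 0) :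
    Projectivization.mk ℂ _ h ∈ cactusVariety n (segreVariety n) := by
  refine subset_zariskiClosure _ ⟨_, isZeroDimSubscheme_ker_coneHom b k, ?_⟩
  intro f hf hf1 v hv hvT
  rw [Set.mem_singleton_iff, Projectivization.mk_eq_mk_iff'] at hvT
  obtain ⟨a, rfl⟩ := hvT
  have hlin : ∀ g ∈ Submodule.span ℂ (Set.range X),
      eval (a • traceTensor b φ) g = a * φ (aeval (basisProduct b) g) := by
    intro g hg
    induction hg using Submodule.span_induction with
    | mem x hx =>
      obtain ⟨i, rfl⟩ := hx
      simp [traceTensor]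
    | zero => simp
    | add x y _ _ hx hy => simp [hx, hy, mul_add]
    | smul c x _ hx => simp [hx, smul_eval]; ring
  rw [hlin f (by rw [← homogeneousSubmodule_one_eq_span_X]; exact hf1)]
  have := (mem_ker_coneHom b f).1 hf 1
  rw [homogeneousComponent_eq_self hf1] at this
  rw [this, map_zero, mul_zero]

/-- By commutativity the trace tensor is symmetric, so one rank computation serves all three choices
of `A`. -/
theorem moveToFront_traceTensor (b : Module.Basis (Fin n) ℂ R) (φ : R →ₗ[ℂ] ℂ) (i : Fin 3) :
    moveToFront i (traceTensor b φ) = traceTensor b φ := by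
  fin_cases i <;> ext x <;> simp [moveToFront, traceTensor, basisProduct] <;> congr 1 <;> ring

end Scheme

/-! ### The left kernel of the tangency flattening of a trace tensor -/

section LeftKernel

/-- The value of a trilinear form on the antisymmetrization of `x ⊗ y ⊗ z`, multiplied by
`1 ⊗ c ⊗ d`. -/
def antisymmetrizedValue {R : Type} [CommRing R] [Algebra ℂ R]
    (G : R →ₗ[ℂ] R →ₗ[ℂ] R →ₗ[ℂ] ℂ) (x y z c d : R) : ℂ :=
  G x (y * c) (z * d) + G y (z * c) (x * d) + G z (x * c) (y * d) -
    G x (z * c) (y * d) - G y (x * c) (z * d) - G z (y * c) (x * d)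

variable (R : Type) [CommRing R] [Algebra ℂ R]

/-- The trilinear forms on `R` that vanish on the `1 ⊗ R ⊗ R`-submodule of `R ⊗ R ⊗ R` generated
by the antisymmetric tensors. -/
def alternantAnnihilator : Submodule ℂ (R →ₗ[ℂ] R →ₗ[ℂ] R →ₗ[ℂ] ℂ) where
  carrier := {G | ∀ x y z c d, antisymmetrizedValue G x y z c d = 0}
  add_mem' {G H} hG hH x y z c d := by
    have h1 := hG x y z c d
    have h2 := hH x y z c d
    simp only [antisymmetrizedValue, LinearMap.add_apply] at h1 h2 ⊢
    linear_combination h1 + h2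
  zero_mem' x y z c d := by simp [antisymmetrizedValue]
  smul_mem' a G hG x y z c d := by
    have h1 := hG x y z c d
    simp only [antisymmetrizedValue, LinearMap.smul_apply, smul_eq_mul] at h1 ⊢
    linear_combination a * h1

variable {R}

theorem Module.Basis.forall_eq_zero_of_isLinearMap {ι M : Type} [AddCommGroup M] [Module ℂ M]
    (b : Module.Basis ι ℂ M) {f : M → ℂ} (hf : IsLinearMap ℂ f) (h : ∀ i, f (b i) = 0) (x : M) :
    f x = 0 := by
  have : hf.mk' f = 0 := b.ext h
  exact DFunLike.congr_fun this x

/-- The expression is linear in each of its five arguments and alternating in the first three, so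
increasing triples of basis elements, which index the columns of the flattening, suffice. -/
theorem mem_alternantAnnihilator_of_basis {ι : Type} [LinearOrder ι] (b : Module.Basis ι ℂ R)
    {G : R →ₗ[ℂ] R →ₗ[ℂ] R →ₗ[ℂ] ℂ}
    (h : ∀ i j k p q, i < j → j < k → antisymmetrizedValue G (b i) (b j) (b k) (b p) (b q) = 0) :
    G ∈ alternantAnnihilator R := by
  have h0 : ∀ i j k p q, antisymmetrizedValue G (b i) (b j) (b k) (b p) (b q) = 0 := by
    intro i j k p q
    rcases lt_trichotomy i j with hij | rfl | hij
    · rcases lt_trichotomy j k with hjk | rfl | hjk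
      · exact h i j k p q hij hjk
      · simp only [antisymmetrizedValue]; ring
      · rcases lt_trichotomy i k with hik | rfl | hik
        · have := h i k j p q hik hjk
          simp only [antisymmetrizedValue] at this ⊢
          linear_combination -this
        · simp only [antisymmetrizedValue]; ring
        · have := h k i j p q hik hij
          simp only [antisymmetrizedValue] at this ⊢
          linear_combination this
    · simp only [antisymmetrizedValue]; ring
    · rcases lt_trichotomy j k with hjk | rfl | hjk
      · rcases lt_trichotomy i k with hik | rfl | hik
        · have := h j i k p q hij hik
          simp only [antisymmetrizedValue] at this ⊢
          linear_combination -this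
        · simp only [antisymmetrizedValue]; ring
        · have := h j k i p q hjk hik
          simp only [antisymmetrizedValue] at this ⊢
          linear_combination this
      · simp only [antisymmetrizedValue]; ring
      · have := h k j i p q hjk hij
        simp only [antisymmetrizedValue] at this ⊢
        linear_combination -this
  intro x y z c d
  refine b.forall_eq_zero_of_isLinearMap (f := fun x => antisymmetrizedValue G x y z c d)
    ⟨fun _ _ => ?_, fun _ _ => ?_⟩ (fun i => ?_) x
  iterate 2
    simp only [antisymmetrizedValue, map_add, map_smul, add_mul, smul_mul_assoc,
      LinearMap.add_apply, LinearMap.smul_apply, smul_eq_mul]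
    ring
  refine b.forall_eq_zero_of_isLinearMap (f := fun y => antisymmetrizedValue G (b i) y z c d)
    ⟨fun _ _ => ?_, fun _ _ => ?_⟩ (fun j => ?_) y
  iterate 2
    simp only [antisymmetrizedValue, map_add, map_smul, add_mul, smul_mul_assoc,
      LinearMap.add_apply, LinearMap.smul_apply, smul_eq_mul]
    ring
  refine b.forall_eq_zero_of_isLinearMap (f := fun z => antisymmetrizedValue G (b i) (b j) z c d)
    ⟨fun _ _ => ?_, fun _ _ => ?_⟩ (fun k => ?_) z
  iterate 2
    simp only [antisymmetrizedValue, map_add, map_smul, add_mul, smul_mul_assoc,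
      LinearMap.add_apply, LinearMap.smul_apply, smul_eq_mul]
    ring
  refine b.forall_eq_zero_of_isLinearMap
    (f := fun c => antisymmetrizedValue G (b i) (b j) (b k) c d)
    ⟨fun _ _ => ?_, fun _ _ => ?_⟩ (fun p => ?_) c
  iterate 2
    simp only [antisymmetrizedValue, map_add, map_smul, mul_add, mul_smul_comm,
      LinearMap.add_apply, LinearMap.smul_apply, smul_eq_mul]
    ring
  refine b.forall_eq_zero_of_isLinearMap
    (f := fun d => antisymmetrizedValue G (b i) (b j) (b k) (b p) d)
    ⟨fun _ _ => ?_, fun _ _ => ?_⟩ (fun q => h0 i j k p q) d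
  iterate 2
    simp only [antisymmetrizedValue, map_add, map_smul, mul_add, mul_smul_comm, smul_eq_mul]
    ring

theorem sum_perm_fin_three (f : Fin 3 → Fin 3 → Fin 3 → ℂ) :
    ∑ σ : Equiv.Perm (Fin 3), ((Equiv.Perm.sign σ : ℤ) : ℂ) * f (σ 0) (σ 1) (σ 2) =
      f 0 1 2 + f 1 2 0 + f 2 0 1 - f 0 2 1 - f 1 0 2 - f 2 1 0 := by
  have h : (Finset.univ : Finset (Equiv.Perm (Fin 3))) =
      {1, finRotate 3, (finRotate 3) ^ 2, Equiv.swap 1 2, Equiv.swap 0 1, Equiv.swap 0 2} := by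
    decide
  rw [h, Finset.sum_insert (by decide), Finset.sum_insert (by decide),
    Finset.sum_insert (by decide), Finset.sum_insert (by decide), Finset.sum_insert (by decide),
    Finset.sum_singleton]
  have s1 : Equiv.Perm.sign (1 : Equiv.Perm (Fin 3)) = 1 := by decide
  have s2 : Equiv.Perm.sign (finRotate 3) = 1 := by decide
  have s3 : Equiv.Perm.sign (finRotate 3 ^ 2) = 1 := by decide
  have s4 : Equiv.Perm.sign (Equiv.swap (1 : Fin 3) 2) = -1 := by decide
  have s5 : Equiv.Perm.sign (Equiv.swap (0 : Fin 3) 1) = -1 := by decide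
  have s6 : Equiv.Perm.sign (Equiv.swap (0 : Fin 3) 2) = -1 := by decide
  have e1 : f ((1 : Equiv.Perm (Fin 3)) 0) ((1 : Equiv.Perm (Fin 3)) 1)
    ((1 : Equiv.Perm (Fin 3)) 2) = f 0 1 2 := rfl
  have e2 : f (finRotate 3 0) (finRotate 3 1) (finRotate 3 2) = f 1 2 0 := rfl
  have e3 : f ((finRotate 3 ^ 2) 0) ((finRotate 3 ^ 2) 1) ((finRotate 3 ^ 2) 2) = f 2 0 1 := rfl
  have e4 : f (Equiv.swap 1 2 0) (Equiv.swap 1 2 1) (Equiv.swap 1 2 2) = f 0 2 1 := rfl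
  have e5 : f (Equiv.swap 0 1 0) (Equiv.swap 0 1 1) (Equiv.swap 0 1 2) = f 1 0 2 := rfl
  have e6 : f (Equiv.swap 0 2 0) (Equiv.swap 0 2 1) (Equiv.swap 0 2 2) = f 2 1 0 := rfl
  rw [s1, s2, s3, s4, s5, s6, e1, e2, e3, e4, e5, e6]
  push_cast
  ring

variable {n : ℕ}

/-- The product of three linear forms as a trilinear form. -/
def trilinearProduct (f g h : R →ₗ[ℂ] ℂ) : R →ₗ[ℂ] R →ₗ[ℂ] R →ₗ[ℂ] ℂ :=
  f.smulRight (g.smulRight h)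

/-- The trilinear form on `R` that a vector of the target space of the tangency flattening
induces through the identification of `R` with its dual. -/
noncomputable def vectorToTrilinear (b : Module.Basis (Fin n) ℂ R) (φ : R →ₗ[ℂ] ℂ) :
    (TensorIndex n → ℂ) →ₗ[ℂ] (R →ₗ[ℂ] R →ₗ[ℂ] R →ₗ[ℂ] ℂ) :=
  Fintype.linearCombination ℂ fun x => trilinearProduct (b.coord x.1)
    (φ ∘ₗ LinearMap.mulRight ℂ (b x.2.1)) (φ ∘ₗ LinearMap.mulRight ℂ (b x.2.2))

theorem vectorToTrilinear_apply (b : Module.Basis (Fin n) ℂ R) (φ : R →ₗ[ℂ] ℂ)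
    (v : TensorIndex n → ℂ) (a : Fin n) (y z : R) :
    vectorToTrilinear b φ v (b a) y z =
      ∑ x : TensorIndex n, v x * ((if x.1 = a then 1 else 0) *
        (φ (y * b x.2.1) * φ (z * b x.2.2))) := by
  simp only [vectorToTrilinear, Fintype.linearCombination_apply, LinearMap.sum_apply]
  refine Finset.sum_congr rfl fun x _ => ?_
  by_cases h : x.1 = a
  · simp [trilinearProduct, h]
  · simp [trilinearProduct, h]

theorem injective_vectorToTrilinear (b : Module.Basis (Fin n) ℂ R) {φ : R →ₗ[ℂ] ℂ}
    (hφ : ∀ x, (∀ y, φ (x * y) = 0) → x = 0) : Function.Injective (vectorToTrilinear b φ) := by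
  have : Module.Finite ℂ R := Module.Finite.of_basis b
  -- By nondegeneracy `P` is an isomorphism; the preimages `y` of the unit vectors form the dual
  -- basis, at which the trilinear form reads off the coordinates of `v`.
  let P : R →ₗ[ℂ] (Fin n → ℂ) := LinearMap.pi fun j => φ ∘ₗ LinearMap.mulRight ℂ (b j)
  have hP : Function.Injective P := by
    rw [← LinearMap.ker_eq_bot, LinearMap.ker_eq_bot']
    intro x hx
    refine hφ x (b.forall_eq_zero_of_isLinearMap ⟨fun _ _ => ?_, fun _ _ => ?_⟩ fun j => ?_)
    · rw [mul_add, map_add]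
    · rw [mul_smul_comm, map_smul]
    · exact congrFun hx j
  have hP' : Function.Surjective P := by
    refine (LinearMap.injective_iff_surjective_of_finrank_eq_finrank ?_).1 hP
    rw [Module.finrank_eq_card_basis b, Module.finrank_fintype_fun_eq_card]
  choose y hy using fun j => hP' (Pi.single j 1)
  have hy' : ∀ i j, φ (y i * b j) = if j = i then 1 else 0 := by
    intro i j
    have := congrFun (hy i) j
    rwa [Pi.single_apply] at this
  refine (injective_iff_map_eq_zero _).2 fun v hv => ?_
  ext ⟨i, j, k⟩
  have h := vectorToTrilinear_apply b φ v i (y j) (y k)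
  rw [hv] at h
  simpa [hy', Fintype.sum_prod_type] using h.symm

/-- The left kernel has dimension `n ^ 3` minus the rank. For a vector in it, the equation of each
column is the vanishing of one antisymmetrized value of the trilinear form attached to the vector.
-/
theorem pow_three_le_rank_add_finrank (b : Module.Basis (Fin n) ℂ R) {φ : R →ₗ[ℂ] ℂ}
    (hφ : ∀ x, (∀ y, φ (x * y) = 0) → x = 0) :
    n ^ 3 ≤ (tangencyMatrix (traceTensor b φ)).rank +
      Module.finrank ℂ (alternantAnnihilator R) := by
  have : Module.Finite ℂ R := Module.Finite.of_basis b
  have : Module.Free ℂ R := Module.Free.of_basis b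
  set M := tangencyMatrix (traceTensor b φ) with hM
  have hrank := LinearMap.finrank_range_add_finrank_ker M.transpose.mulVecLin
  have hcard : Module.finrank ℂ (TensorIndex n → ℂ) = n ^ 3 := by
    simp only [Module.finrank_fintype_fun_eq_card, Fintype.card_prod, Fintype.card_fin]
    ring
  rw [hcard, ← Matrix.rank, Matrix.rank_transpose] at hrank
  rw [← hrank]
  gcongr
  have hmem : ∀ v ∈ LinearMap.ker M.transpose.mulVecLin,
      vectorToTrilinear b φ v ∈ alternantAnnihilator R := by
    intro v hv
    refine mem_alternantAnnihilator_of_basis b fun i j k p q hij hjk => ?_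
    let s : Fin 3 ↪o Fin n := OrderEmbedding.ofStrictMono ![i, j, k] (by
      rw [Fin.strictMono_iff_lt_succ]
      intro t
      fin_cases t
      · exact hij
      · exact hjk)
    have hs : ∀ t, s t = ![i, j, k] t := fun _ => rfl
    -- The last column index multiplies the second argument and the middle one the third, hence `q`
    -- before `p`.
    have h0 := congrFun (LinearMap.mem_ker.1 hv) (s, q, p)
    have h1 := sum_perm_fin_three fun t₀ t₁ t₂ =>
      vectorToTrilinear b φ v (b (s t₀)) (b (s t₁) * b p) (b (s t₂) * b q)
    rw [antisymmetrizedValue]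
    refine h1.symm.trans (Eq.trans ?_ h0)
    simp only [vectorToTrilinear_apply, Matrix.mulVecLin_apply, Matrix.mulVec, dotProduct,
      Matrix.transpose_apply, hM, tangencyMatrix, Matrix.of_apply, traceTensor, basisProduct,
      Finset.sum_mul, Finset.mul_sum]
    rw [Finset.sum_comm]
    refine Finset.sum_congr rfl fun x _ => Finset.sum_congr rfl fun σ _ => ?_
    rw [mul_right_comm (b (s (σ 1)))]
    ring
  have hinj : Function.Injective ((vectorToTrilinear b φ).restrict hmem) := by
    intro v w h
    exact Subtype.ext (injective_vectorToTrilinear b hφ (congrArg Subtype.val h))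
  exact LinearMap.finrank_le_finrank_of_injective hinj

end LeftKernel

/-! ### Frobenius algebras with a small annihilator of alternants, and their products with `ℂ` -/

section Product

/-- The restriction of a trilinear form along a linear map. -/
def trilinearPullback {R S : Type} [AddCommGroup R] [Module ℂ R] [AddCommGroup S] [Module ℂ S]
    (i : R →ₗ[ℂ] S) : (S →ₗ[ℂ] S →ₗ[ℂ] S →ₗ[ℂ] ℂ) →ₗ[ℂ] (R →ₗ[ℂ] R →ₗ[ℂ] R →ₗ[ℂ] ℂ) :=
  LinearMap.compRight ℂ (LinearMap.compRight ℂ (LinearMap.lcomp ℂ ℂ i) ∘ₗ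
    LinearMap.lcomp ℂ (S →ₗ[ℂ] ℂ) i) ∘ₗ LinearMap.lcomp ℂ (S →ₗ[ℂ] S →ₗ[ℂ] ℂ) i

theorem trilinearPullback_apply {R S : Type} [AddCommGroup R] [Module ℂ R] [AddCommGroup S]
    [Module ℂ S] (i : R →ₗ[ℂ] S) (G : S →ₗ[ℂ] S →ₗ[ℂ] S →ₗ[ℂ] ℂ) (x y z : R) :
    trilinearPullback i G x y z = G (i x) (i y) (i z) := rfl

/-- The evaluation of trilinear forms at the points of a family. -/
def trilinearEval {R κ : Type} [AddCommGroup R] [Module ℂ R] (p : κ → R × R × R) :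
    (R →ₗ[ℂ] R →ₗ[ℂ] R →ₗ[ℂ] ℂ) →ₗ[ℂ] (κ → ℂ) :=
  LinearMap.pi fun k => LinearMap.applyₗ (p k).2.2 ∘ₗ LinearMap.applyₗ (p k).2.1 ∘ₗ
    LinearMap.applyₗ (p k).1

/-- The additive inverses of a space of trilinear forms, for the default search of instances
does not find them. -/
instance {R : Type} [AddCommGroup R] [Module ℂ R]
    (K : Submodule ℂ (R →ₗ[ℂ] R →ₗ[ℂ] R →ₗ[ℂ] ℂ)) : AddCommGroup K :=
  Module.addCommMonoidToAddCommGroup ℂ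

theorem finrank_le_card_of_forall_eval {R κ : Type} [AddCommGroup R] [Module ℂ R] [Fintype κ]
    (K : Submodule ℂ (R →ₗ[ℂ] R →ₗ[ℂ] R →ₗ[ℂ] ℂ)) (p : κ → R × R × R)
    (h : ∀ G ∈ K, (∀ k, G (p k).1 (p k).2.1 (p k).2.2 = 0) → G = 0) :
    Module.finrank ℂ K ≤ Fintype.card κ := by
  rw [← Module.finrank_fintype_fun_eq_card ℂ]
  refine LinearMap.finrank_le_finrank_of_injective (f := trilinearEval p ∘ₗ K.subtype) ?_
  refine (injective_iff_map_eq_zero _).2 fun G hG => Subtype.ext (h G G.2 fun k => ?_)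
  exact congrFun hG k

variable (R : Type) [CommRing R] [Algebra ℂ R]

theorem trilinearPullback_inl_mem {G : R × ℂ →ₗ[ℂ] R × ℂ →ₗ[ℂ] R × ℂ →ₗ[ℂ] ℂ}
    (hG : G ∈ alternantAnnihilator (R × ℂ)) :
    trilinearPullback (LinearMap.inl ℂ R ℂ) G ∈ alternantAnnihilator R := by
  intro x y z c d
  have := hG (x, 0) (y, 0) (z, 0) (c, 0) (d, 0)
  simpa [antisymmetrizedValue, trilinearPullback_apply] using this

/-- The arguments of a trilinear form on `R × ℂ` in which the second factor occurs, as linear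
functions of one element of `R`. -/
def mixedArguments (t : Fin 6) (w : R) : (R × ℂ) × (R × ℂ) × (R × ℂ) :=
  ![((1, 0), (w, 0), (0, 1)), ((w, 0), (0, 1), (1, 0)), ((0, 1), (1, 0), (w, 0)),
    ((0, 1), (0, 1), (w, 0)), ((0, 1), (w, 0), (0, 1)), ((w, 0), (0, 1), (0, 1))] t

variable {R}

/-- Put `e = (1, 0)` and `f = (0, 1)`. As `e f = 0`, the relations reduce to `G(x, y, f) = G(e, xy,
f)`, `G(x, f, y) = G(e, f, xy)` and `G(f, x, y) = G(f, e, xy)` for `x`, `y` in `R`. So each of the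
six mixed types depends on one element of `R`. -/
theorem eq_zero_of_mem_alternantAnnihilator_prod
    {G : R × ℂ →ₗ[ℂ] R × ℂ →ₗ[ℂ] R × ℂ →ₗ[ℂ] ℂ}
    (hG : G ∈ alternantAnnihilator (R × ℂ)) (hR : trilinearPullback (LinearMap.inl ℂ R ℂ) G = 0)
    (hmix : ∀ t w, G (mixedArguments R t w).1 (mixedArguments R t w).2.1
      (mixedArguments R t w).2.2 = 0)
    (h1 : G (0, 1) (0, 1) (0, 1) = 0) : G = 0 := by
  have hz : ((0, 0) : R × ℂ) = 0 := rfl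
  have h000 : ∀ x y z : R, G (x, 0) (y, 0) (z, 0) = 0 := fun x y z => by
    rw [← LinearMap.inl_apply (R := ℂ), ← LinearMap.inl_apply (R := ℂ),
      ← LinearMap.inl_apply (R := ℂ), ← trilinearPullback_apply, hR]
    rfl
  have h001 : ∀ x y : R, G (x, 0) (y, 0) (0, 1) = 0 := by
    intro x y
    have h := hG (x, 0) (1, 0) (0, 1) (y, 0) (0, 1)
    have h' : G (1, 0) (x * y, 0) (0, 1) = 0 := hmix 0 (x * y)
    simpa [antisymmetrizedValue, h', hz] using h
  have h010 : ∀ x y : R, G (x, 0) (0, 1) (y, 0) = 0 := by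
    -- This is used twice, since the prescribed values are of the form `G(w, f, e)`: both `G(x, f,
    -- y)` and `G(xy, f, e)` equal `G(e, f, xy)`.
    have key : ∀ x y : R, G (x, 0) (0, 1) (y, 0) = G (1, 0) (0, 1) (x * y, 0) := by
      intro x y
      have h := hG (x, 0) (1, 0) (0, 1) (0, 1) (y, 0)
      simp only [antisymmetrizedValue, Prod.mk_mul_mk, mul_zero, zero_mul, mul_one, one_mul,
        Prod.mk_zero_zero, map_zero, LinearMap.zero_apply] at h
      linear_combination -h
    intro x y
    have h' : G (x * y, 0) (0, 1) (1, 0) = 0 := hmix 1 (x * y)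
    rw [key, ← mul_one (x * y), ← key, h']
  have h100 : ∀ x y : R, G (0, 1) (x, 0) (y, 0) = 0 := by
    intro x y
    have h := hG (0, 1) (x, 0) (1, 0) (1, 0) (y, 0)
    have h' : G (0, 1) (1, 0) (x * y, 0) = 0 := hmix 2 (x * y)
    simpa [antisymmetrizedValue, h', hz] using h
  have h110 : ∀ w : R, G (0, 1) (0, 1) (w, 0) = 0 := hmix 3
  have h101 : ∀ w : R, G (0, 1) (w, 0) (0, 1) = 0 := hmix 4
  have h011 : ∀ w : R, G (w, 0) (0, 1) (0, 1) = 0 := hmix 5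
  ext x y z
  all_goals simp [h000, h001, h010, h100, h110, h101, h011, h1]

/-- The six mixed types contribute `6 n` values on a basis of `R`, and the cube of the second factor
contributes one. -/
theorem finrank_alternantAnnihilator_prod_le [Module.Finite ℂ R] {n : ℕ} (hn : Module.finrank ℂ R = n) :
    Module.finrank ℂ (alternantAnnihilator (R × ℂ)) ≤
      Module.finrank ℂ (alternantAnnihilator R) + (6 * n + 1) := by
  let b := Module.finBasisOfFinrankEq ℂ R hn
  let p : (Fin 6 × Fin n) ⊕ Unit → (R × ℂ) × (R × ℂ) × (R × ℂ) :=
    Sum.elim (fun q => mixedArguments R q.1 (b q.2)) fun _ => ((0, 1), (0, 1), (0, 1))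
  let L : alternantAnnihilator (R × ℂ) →ₗ[ℂ] alternantAnnihilator R ×
      ((Fin 6 × Fin n) ⊕ Unit → ℂ) :=
    LinearMap.prod
      ((trilinearPullback (LinearMap.inl ℂ R ℂ)).restrict fun _ hG =>
        trilinearPullback_inl_mem R hG)
      (trilinearEval p ∘ₗ (alternantAnnihilator (R × ℂ)).subtype)
  have hL : Function.Injective L := by
    refine (injective_iff_map_eq_zero _).2 fun G hG => Subtype.ext ?_
    have hp : ∀ k, G.1 (p k).1 (p k).2.1 (p k).2.2 = 0 := congrFun (congrArg Prod.snd hG)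
    refine eq_zero_of_mem_alternantAnnihilator_prod G.2
      (congrArg Subtype.val (congrArg Prod.fst hG)) (fun t w => ?_) (hp (Sum.inr ()))
    refine b.forall_eq_zero_of_isLinearMap (f := fun w => G.1 (mixedArguments R t w).1
      (mixedArguments R t w).2.1 (mixedArguments R t w).2.2) ?_ (fun j => hp (Sum.inl (t, j))) w
    have hadd : ∀ x y : R, ((x + y, 0) : R × ℂ) = (x, 0) + (y, 0) := fun x y => by simp
    have hsmul : ∀ (a : ℂ) (x : R), ((a • x, 0) : R × ℂ) = a • (x, 0) := fun a x => by simp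
    constructor <;> intros <;> fin_cases t <;> simp [mixedArguments, hadd, hsmul, -Prod.mk_add_mk,
      -Prod.smul_mk]
  refine (LinearMap.finrank_le_finrank_of_injective hL).trans ?_
  rw [Module.finrank_prod, Module.finrank_fintype_fun_eq_card, Fintype.card_sum,
    Fintype.card_prod, Fintype.card_fin, Fintype.card_fin, Fintype.card_unit]

/-- There is a Frobenius algebra of dimension `n` over `ℂ` for which the dimension of the
annihilator of alternants is less than `3 n ^ 2 - 2 n`, its value for `ℂ ^ n`. -/
def ExistsFrobeniusAlgebra (n : ℕ) : Prop :=
  ∃ (R : Type) (_ : CommRing R) (_ : Algebra ℂ R) (φ : R →ₗ[ℂ] ℂ),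
    Module.Finite ℂ R ∧ Module.finrank ℂ R = n ∧ (∀ x, (∀ y, φ (x * y) = 0) → x = 0) ∧
      Module.finrank ℂ (alternantAnnihilator R) + 2 * n + 1 ≤ 3 * n ^ 2

/-- The difference of `3 n² - 2 n` at `n + 1` and at `n` is exactly `6 n + 1`. -/
theorem ExistsFrobeniusAlgebra.succ {n : ℕ} (h : ExistsFrobeniusAlgebra n) :
    ExistsFrobeniusAlgebra (n + 1) := by
  obtain ⟨R, _, _, φ, _, hn, hφ, hK⟩ := h
  refine ⟨R × ℂ, inferInstance, inferInstance, φ.coprod LinearMap.id, inferInstance, ?_, ?_, ?_⟩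
  · rw [Module.finrank_prod, hn, Module.finrank_self]
  · rintro ⟨r, s⟩ h
    have hs : s = 0 := by simpa using h (0, 1)
    have hr : r = 0 := hφ r fun y => by simpa using h (y, 0)
    rw [hs, hr, Prod.mk_zero_zero]
  · have := finrank_alternantAnnihilator_prod_le (R := R) hn
    nlinarith

end Product

/-! ### Vanishing of the solutions of a system of linear relations with few terms -/

section Propagation

variable {α : Type}

/-- Goes through a list of relations `v a + v b = v c + v d`. If all positions in a relation but
one are known zeros of `v`, then this position is added to the known zeros. In the end, it is
checked whether all targets are known zeros. In the relations, `none` stands for a zero of `v`;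
the set of known zeros is given by the binary digits of a number. -/
def propagates (code : α → ℕ) (targets : List α) : List (List (Option α)) → ℕ → Bool
  | [], known => targets.all fun a => known.testBit (code a)
  | r :: rels, known =>
    match r.filter fun o => !o.all fun a => known.testBit (code a) with
    | [some a] => propagates code targets rels (known ||| 2 ^ code a)
    | _ => propagates code targets rels known

/-- A single remaining entry has coefficient `1` or `-1`, so it vanishes. An unknown that occurs
twice leaves two entries, and such a relation is not used. -/
theorem eq_zero_of_propagates (v : α → ℂ) {code : α → ℕ} (hcode : Function.Injective code)
    {targets : List α} (rels : List (List (Option α)))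
    (hr : ∀ r ∈ rels, ∃ a b c d, r = [a, b, c, d] ∧
      a.elim 0 v + b.elim 0 v = c.elim 0 v + d.elim 0 v) (known : ℕ)
    (hk : ∀ a, known.testBit (code a) = true → v a = 0)
    (h : propagates code targets rels known = true) : ∀ a ∈ targets, v a = 0 := by
  induction rels generalizing known with
  | nil => exact fun a ha => hk a (List.all_eq_true.1 h a ha)
  | cons r rels ih =>
    have ih' := ih fun r hr' => hr r (List.mem_cons_of_mem _ hr')
    unfold propagates at h
    split at h
    · rename_i y hy
      refine ih' (known ||| 2 ^ code y) (fun x hx => ?_) h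
      rw [Nat.testBit_or, Nat.testBit_two_pow, Bool.or_eq_true, decide_eq_true_eq] at hx
      rcases hx with hx | hx
      · exact hk x hx
      · obtain rfl := hcode hx
        obtain ⟨a, b, c, d, rfl, h⟩ := hr r List.mem_cons_self
        have hz : ∀ o : Option α, (o.all fun a => known.testBit (code a)) = true →
            o.elim 0 v = 0 := by
          rintro (_ | a) ha
          · rfl
          · exact hk a ha
        -- Of the sixteen cases only the four with exactly one unknown entry are compatible with
        -- `hy`.
        by_cases ha : (a.all fun a => known.testBit (code a)) = true <;>
        by_cases hb : (b.all fun a => known.testBit (code a)) = true <;>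
        by_cases hc : (c.all fun a => known.testBit (code a)) = true <;>
        by_cases hd : (d.all fun a => known.testBit (code a)) = true <;>
        simp only [List.filter_cons, List.filter_nil, ha, hb, hc, hd, Bool.not_true,
          Bool.not_false, if_true, List.cons.injEq, reduceCtorEq, and_false, and_true,
          Bool.false_eq_true, if_false] at hy
        · rw [hz a ha, hz b hb, hz c hc, hy] at h
          simpa using h.symm
        · rw [hz a ha, hz b hb, hz d hd, hy] at h
          simpa using h.symm
        · rw [hz a ha, hz d hd, hz c hc, hy] at h
          simpa using h
        · rw [hz d hd, hz b hb, hz c hc, hy] at h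
          simpa using h
    · exact ih' known hk h

/-- The relation `v a + 0 = 0 + 0`. -/
def zeroRelation (a : α) : List (Option α) := [some a, none, none, none]

end Propagation

/-! ### The relations for the parts of degree four and five -/

/-- The multiplication table of the partial derivatives of order one of the cubic form
`3 X₀ X₁² + 3 X₀ X₃² + 3 X₀² X₅ + 3 X₂ X₄² + 6 X₁ X₄ X₅ + 6 X₂ X₃ X₅`: the product of two
of them is a derivative of order two, dual to one of the variables, or zero. -/
def cubicTable : Fin 6 → Fin 6 → Option (Fin 6) :=
  ![![some 5, some 1, none, some 3, none, some 0],
    ![some 1, some 0, none, none, some 5, some 4],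
    ![none, none, none, some 5, some 4, some 3],
    ![some 3, none, some 5, some 0, none, some 2],
    ![none, some 5, some 4, none, some 2, some 1],
    ![some 0, some 4, some 3, some 2, some 1, none]]

/-- The ordered form of the position of `g i j k`, where `g i j = g j i`. -/
def quarticEntry (i j : Fin 6) : Option (Fin 6) → Option (Fin 6 × Fin 6 × Fin 6) :=
  Option.map fun k => (min i j, max i j, k)

/-- The relation of degree four that belongs to a product of four variables. -/
def quarticRelation (p : Fin 6 × Fin 6 × Fin 6 × Fin 6) : List (Option (Fin 6 × Fin 6 × Fin 6)) :=
  [quarticEntry p.1 p.2.1 (cubicTable p.2.2.1 p.2.2.2),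
    quarticEntry p.2.2.1 p.2.2.2 (cubicTable p.1 p.2.1),
    quarticEntry p.1 p.2.2.1 (cubicTable p.2.1 p.2.2.2),
    quarticEntry p.2.1 p.2.2.2 (cubicTable p.1 p.2.2.1)]

/-- Positions that determine the solutions of the relations of degree four. -/
def quarticPositions : List (Fin 6 × Fin 6 × Fin 6) :=
  [(1, 5, 0), (0, 0, 5), (4, 4, 0), (0, 1, 3), (2, 4, 3), (4, 5, 2), (2, 3, 4), (1, 3, 3),
   (1, 1, 1), (1, 1, 3), (4, 4, 2), (1, 3, 1), (4, 4, 5), (0, 4, 4), (3, 3, 5), (4, 5, 1),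
   (0, 4, 0), (4, 5, 5), (3, 5, 4), (1, 4, 3), (2, 3, 3), (2, 4, 1), (0, 3, 3), (1, 5, 4),
   (0, 5, 0), (3, 3, 0), (0, 3, 2)]

/-- Relations of degree four, in an order in which the positions in `quarticPositions` let all
other ones be found. -/
def quarticSteps : List (Fin 6 × Fin 6 × Fin 6 × Fin 6) :=
  [(0, 0, 2, 2), (0, 0, 3, 3), (0, 0, 4, 4), (0, 0, 4, 5), (0, 0, 5, 5), (0, 1, 2, 2),
   (0, 1, 3, 1), (0, 1, 4, 2), (0, 1, 4, 3), (0, 1, 4, 5), (0, 2, 1, 4), (0, 2, 3, 1),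
   (0, 2, 3, 2), (0, 2, 3, 4), (0, 2, 4, 2), (0, 2, 4, 3), (0, 2, 4, 4), (0, 2, 5, 1),
   (0, 3, 1, 4), (0, 3, 2, 3), (0, 3, 2, 5), (0, 3, 4, 3), (0, 3, 4, 4), (0, 3, 5, 3),
   (0, 5, 1, 2), (1, 0, 1, 0), (1, 0, 1, 2), (1, 1, 2, 2), (1, 1, 2, 3), (1, 1, 3, 3),
   (1, 1, 5, 0), (1, 1, 5, 5), (1, 2, 3, 2), (1, 2, 3, 3), (1, 2, 3, 4), (1, 2, 3, 5),
   (1, 2, 4, 2), (1, 2, 4, 5), (1, 2, 5, 2), (1, 2, 5, 3), (1, 2, 5, 4), (1, 3, 0, 0),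
   (1, 3, 1, 4), (1, 3, 4, 3), (1, 3, 5, 4), (1, 3, 5, 5), (1, 4, 0, 5), (1, 4, 5, 5),
   (1, 5, 1, 2), (2, 0, 1, 0), (2, 0, 2, 5), (2, 0, 3, 0), (2, 0, 5, 0), (2, 0, 5, 4),
   (2, 0, 5, 5), (2, 1, 3, 4), (2, 2, 3, 4), (2, 2, 3, 5), (2, 2, 4, 5), (2, 3, 4, 4),
   (2, 3, 5, 4), (2, 3, 5, 5), (2, 4, 0, 0), (2, 4, 1, 4), (2, 4, 3, 5), (2, 5, 1, 5),
   (3, 0, 1, 5), (3, 0, 2, 1), (3, 0, 4, 0), (3, 0, 4, 5), (3, 0, 5, 0), (3, 0, 5, 4),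
   (3, 1, 4, 4), (3, 1, 5, 4), (3, 2, 3, 5), (3, 3, 1, 5), (3, 3, 2, 4), (3, 3, 4, 4),
   (3, 4, 5, 4), (3, 4, 5, 5), (3, 5, 0, 1), (4, 0, 1, 0), (4, 0, 1, 1), (4, 0, 2, 5),
   (4, 0, 4, 1), (4, 0, 4, 5), (4, 1, 2, 1), (4, 1, 4, 1), (4, 1, 4, 5), (4, 1, 5, 1),
   (4, 2, 5, 5), (4, 4, 5, 5), (4, 5, 0, 5), (5, 0, 1, 0), (5, 0, 5, 1), (5, 1, 3, 1),
   (5, 3, 5, 0), (0, 1, 3, 3), (3, 3, 4, 5)]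

/-- A number that encodes a triple. -/
def tripleCode (p : Fin 6 × Fin 6 × Fin 6) : ℕ := 36 * p.1 + 6 * p.2.1 + p.2.2

theorem tripleCode_injective : Function.Injective tripleCode := by
  rintro ⟨⟨a, ha⟩, ⟨b, hb⟩, ⟨c, hc⟩⟩ ⟨⟨d, hd⟩, ⟨e, he⟩, ⟨f, hf⟩⟩ h
  simp only [tripleCode] at h
  simp only [Prod.mk.injEq, Fin.mk.injEq]
  omega

/-- Of the `21 * 6 = 126` unknowns, 27 are prescribed and each of the 99 relations yields one more.
-/
theorem quartic_propagates :
    propagates tripleCode ((List.finRange 6 ×ˢ List.finRange 6 ×ˢ List.finRange 6).filter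
      fun p => p.1 ≤ p.2.1)
      (quarticPositions.map zeroRelation ++ quarticSteps.map quarticRelation) 0 = true := by
  decide +kernel

/-- Here `g i j k` stands for the value of a symmetric trilinear form at `X i`, `X j`, `Y k`, where
the `Y k` are dual to the generators `X i`. -/
theorem quartic_eq_zero (g : Fin 6 → Fin 6 → Fin 6 → ℂ) (hs : ∀ i j k, g i j k = g j i k)
    (hr : ∀ i j k l, (cubicTable k l).elim 0 (g i j) + (cubicTable i j).elim 0 (g k l) =
      (cubicTable j l).elim 0 (g i k) + (cubicTable i k).elim 0 (g j l))
    (hz : ∀ p ∈ quarticPositions, g p.1 p.2.1 p.2.2 = 0) (i j k : Fin 6) : g i j k = 0 := by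
  have hentry : ∀ i j o, (quarticEntry i j o).elim 0 (fun p => g p.1 p.2.1 p.2.2) =
      o.elim 0 (g i j) := by
    rintro i j (_ | k)
    · rfl
    · rcases le_total i j with h | h
      · simp [quarticEntry, h]
      · simp [quarticEntry, h, hs i j]
  have h := eq_zero_of_propagates (fun p => g p.1 p.2.1 p.2.2) tripleCode_injective _ ?_ 0
    (by simp) quartic_propagates
  · rcases le_total i j with hij | hij
    · exact h (i, j, k) (by simpa using hij)
    · rw [hs]
      exact h (j, i, k) (by simpa using hij)
  · intro r hr'
    rcases List.mem_append.1 hr' with hr' | hr'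
    · obtain ⟨p, hp, rfl⟩ := List.mem_map.1 hr'
      exact ⟨_, _, _, _, rfl, by simpa using hz p hp⟩
    · obtain ⟨⟨a, b, c, d⟩, -, rfl⟩ := List.mem_map.1 hr'
      refine ⟨_, _, _, _, rfl, ?_⟩
      simp only [hentry]
      exact hr a b c d

/-! ### Elimination in degree five -/

/-- The ordered form of the position of `h i j`, where `h i j = h j i`. -/
def quinticEntryLeft (i j : Fin 6) : (Fin 6 × Fin 6) ⊕ (Fin 6 × Fin 6 × Fin 6) :=
  Sum.inl (min i j, max i j)

/-- The ordered form of the position of `P c i j`, where `P c i j = P c j i`. -/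
def quinticEntryRight (c i : Fin 6) :
    Option (Fin 6) → Option ((Fin 6 × Fin 6) ⊕ (Fin 6 × Fin 6 × Fin 6)) :=
  Option.map fun j => Sum.inr (c, min i j, max i j)

/-- The relation of degree five that belongs to three variables and a derivative of order two. -/
def quinticRelation (p : Fin 6 × Fin 6 × Fin 6 × Fin 6) :
    List (Option ((Fin 6 × Fin 6) ⊕ (Fin 6 × Fin 6 × Fin 6))) :=
  [if p.2.2.2 = p.2.2.1 then some (quinticEntryLeft p.1 p.2.1) else none,
    quinticEntryRight p.2.2.1 p.2.2.2 (cubicTable p.1 p.2.1),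
    if p.2.2.2 = p.1 then some (quinticEntryLeft p.2.2.1 p.2.1) else none,
    quinticEntryRight p.1 p.2.2.2 (cubicTable p.2.2.1 p.2.1)]

/-- Positions that determine the solutions of the relations of degree five. -/
def quinticPositions : List (Fin 6 × Fin 6 × Fin 6) :=
  [(4, 4, 5), (4, 0, 4), (0, 0, 1), (3, 2, 3), (5, 4, 5), (2, 2, 3)]

/-- Relations of degree five, in an order in which the positions in `quinticPositions` let all
other ones be found. -/
def quinticSteps : List (Fin 6 × Fin 6 × Fin 6 × Fin 6) :=
  [(0, 0, 2, 1), (0, 0, 2, 3), (0, 0, 2, 4), (0, 0, 2, 5), (0, 0, 4, 1), (0, 0, 4, 2),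
   (0, 0, 4, 3), (0, 0, 4, 4), (0, 0, 4, 5), (0, 0, 5, 1), (0, 0, 5, 4), (0, 1, 1, 4),
   (0, 1, 2, 1), (0, 1, 2, 3), (0, 1, 2, 4), (0, 1, 3, 1), (0, 1, 3, 2), (0, 1, 3, 4),
   (0, 1, 3, 5), (0, 1, 4, 5), (0, 2, 1, 0), (0, 2, 1, 1), (0, 2, 2, 0), (0, 2, 3, 1),
   (0, 2, 3, 2), (0, 2, 3, 3), (0, 2, 3, 4), (0, 2, 4, 0), (0, 2, 4, 1), (0, 2, 4, 2),
   (0, 2, 4, 3), (0, 2, 4, 4), (0, 2, 5, 1), (0, 2, 5, 2), (0, 2, 5, 3), (0, 3, 1, 2),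
   (0, 3, 1, 3), (0, 3, 1, 4), (0, 3, 1, 5), (0, 3, 2, 2), (0, 3, 2, 3), (0, 3, 2, 4),
   (0, 3, 3, 1), (0, 3, 3, 2), (0, 3, 3, 4), (0, 3, 4, 1), (0, 3, 4, 2), (0, 3, 4, 3),
   (0, 3, 4, 4), (0, 3, 5, 3), (0, 3, 5, 4), (0, 3, 5, 5), (0, 4, 1, 1), (0, 4, 3, 0),
   (0, 4, 4, 0), (0, 4, 4, 1), (0, 4, 4, 2), (0, 4, 5, 0), (0, 4, 5, 1), (0, 5, 1, 2),
   (0, 5, 1, 3), (0, 5, 1, 4), (0, 5, 1, 5), (0, 5, 2, 1), (0, 5, 2, 3), (0, 5, 2, 4),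
   (0, 5, 2, 5), (0, 5, 3, 1), (0, 5, 3, 2), (0, 5, 3, 4), (0, 5, 3, 5), (0, 5, 4, 0),
   (0, 5, 4, 1), (0, 5, 4, 2), (0, 5, 4, 3), (0, 5, 4, 4), (0, 5, 4, 5), (0, 5, 5, 1),
   (0, 5, 5, 2), (0, 5, 5, 3), (0, 5, 5, 4), (0, 5, 5, 5), (1, 0, 0, 0), (1, 0, 0, 1),
   (1, 0, 0, 2), (1, 0, 0, 4), (1, 0, 0, 5), (1, 0, 2, 2), (1, 0, 3, 1), (1, 0, 4, 1),
   (1, 0, 4, 2), (1, 0, 4, 4), (1, 0, 5, 0), (1, 0, 5, 2), (1, 0, 5, 3), (1, 0, 5, 4),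
   (1, 1, 0, 1), (1, 1, 0, 2), (1, 1, 0, 3), (1, 1, 0, 5), (1, 1, 2, 0), (1, 1, 3, 0),
   (1, 1, 3, 1), (1, 1, 4, 1), (1, 1, 4, 4), (1, 1, 5, 0), (1, 1, 5, 1), (1, 1, 5, 2),
   (1, 1, 5, 4), (1, 2, 3, 1), (1, 2, 5, 1), (1, 3, 5, 1), (1, 3, 5, 2), (1, 4, 2, 2),
   (1, 4, 3, 2), (1, 4, 3, 3), (1, 4, 3, 4), (1, 4, 3, 5), (1, 4, 5, 0), (1, 4, 5, 2),
   (1, 4, 5, 5), (1, 5, 2, 2), (1, 5, 2, 4), (1, 5, 3, 2), (1, 5, 3, 4), (1, 5, 4, 2),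
   (1, 5, 4, 4), (1, 5, 5, 1), (1, 5, 5, 2), (1, 5, 5, 4), (2, 0, 5, 2), (2, 3, 3, 2),
   (2, 3, 5, 2), (2, 5, 3, 0), (2, 5, 3, 3), (2, 5, 5, 2), (3, 3, 0, 0), (3, 3, 5, 2),
   (3, 5, 4, 2), (3, 5, 5, 2), (4, 5, 5, 1)]

/-- A number that encodes a pair or a triple. -/
def pairOrTripleCode : (Fin 6 × Fin 6) ⊕ (Fin 6 × Fin 6 × Fin 6) → ℕ :=
  Sum.elim (fun p => 216 + (6 * p.1 + p.2)) tripleCode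

/-- Codes of triples are below `216 = 6 ^ 3`, so the shifted codes of pairs do not meet them. -/
theorem pairOrTripleCode_injective : Function.Injective pairOrTripleCode := by
  refine Function.Injective.sumElim ?_ tripleCode_injective ?_
  · rintro ⟨⟨a, ha⟩, ⟨b, hb⟩⟩ ⟨⟨c, hc⟩, ⟨d, hd⟩⟩ h
    simp only at h
    simp only [Prod.mk.injEq, Fin.mk.injEq]
    omega
  · rintro p ⟨⟨c, hc⟩, ⟨d, hd⟩, ⟨e, he⟩⟩
    simp only [tripleCode]
    omega

/-- Of the `21 + 6 * 21 = 147` unknowns, 6 are prescribed and each of the 141 relations yields one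
more. -/
theorem quintic_propagates :
    propagates pairOrTripleCode
      (((List.finRange 6 ×ˢ List.finRange 6).filter fun p => p.1 ≤ p.2).map Sum.inl ++
        ((List.finRange 6 ×ˢ List.finRange 6 ×ˢ List.finRange 6).filter
          fun p => p.2.1 ≤ p.2.2).map Sum.inr)
      (quinticPositions.map (fun p => zeroRelation (Sum.inr p)) ++
        quinticSteps.map quinticRelation) 0 = true := by
  decide +kernel

/-- Here `h i j` stands for a value at `X i`, `X j`, `W` and `P c i j` for one at `X c`, `Y i`, `Y
j`, with `W` the socle generator; the relations link the two types. -/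
theorem quintic_eq_zero (h : Fin 6 → Fin 6 → ℂ) (P : Fin 6 → Fin 6 → Fin 6 → ℂ)
    (hh : ∀ i j, h i j = h j i) (hP : ∀ c i j, P c i j = P c j i)
    (hr : ∀ a b c q, (if q = c then h a b else 0) + (cubicTable a b).elim 0 (P c q) =
      (if q = a then h c b else 0) + (cubicTable c b).elim 0 (P a q))
    (hz : ∀ p ∈ quinticPositions, P p.1 p.2.1 p.2.2 = 0) :
    (∀ i j, h i j = 0) ∧ ∀ c i j, P c i j = 0 := by
  let v : (Fin 6 × Fin 6) ⊕ (Fin 6 × Fin 6 × Fin 6) → ℂ :=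
    Sum.elim (fun p => h p.1 p.2) fun p => P p.1 p.2.1 p.2.2
  have hleft : ∀ i j, v (quinticEntryLeft i j) = h i j := by
    intro i j
    rcases le_total i j with hij | hij
    · simp [v, quinticEntryLeft, hij]
    · simp [v, quinticEntryLeft, hij, hh i j]
  have hleft' : ∀ (p : Prop) [Decidable p] (i j : Fin 6),
      (if p then some (quinticEntryLeft i j) else none).elim 0 v = if p then h i j else 0 := by
    intro p _ i j
    split_ifs
    · exact hleft i j
    · rfl
  have hright : ∀ c i o, (quinticEntryRight c i o).elim 0 v = o.elim 0 (P c i) := by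
    rintro c i (_ | j)
    · rfl
    · rcases le_total i j with hij | hij
      · simp [v, quinticEntryRight, hij]
      · simp [v, quinticEntryRight, hij, hP c i j]
  have hv := eq_zero_of_propagates v pairOrTripleCode_injective _ ?_ 0 (by simp) quintic_propagates
  · constructor
    · intro i j
      rw [← hleft]
      exact hv _ (List.mem_append_left _ (List.mem_map_of_mem (by simp)))
    · intro c i j
      have := hright c i (some j)
      refine this.symm.trans (hv _ (List.mem_append_right _ (List.mem_map_of_mem (by simp))))
  · intro r hr'
    rcases List.mem_append.1 hr' with hr' | hr'
    · obtain ⟨p, hp, rfl⟩ := List.mem_map.1 hr'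
      exact ⟨_, _, _, _, rfl, by simpa [v] using hz p hp⟩
    · obtain ⟨⟨a, b, c, q⟩, -, rfl⟩ := List.mem_map.1 hr'
      refine ⟨_, _, _, _, rfl, ?_⟩
      simp only [hleft', hright]
      exact hr a b c q

/-! ### A Gorenstein algebra with Hilbert function `(1, 6, 6, 1)` -/

/-- The structure constants of the product of two variables. -/
def cubicCoeff (i j k : Fin 6) : ℂ := if cubicTable i j = some k then 1 else 0

theorem cubicCoeff_comm (i j k : Fin 6) : cubicCoeff i j k = cubicCoeff j i k := by
  have : ∀ i j, cubicTable i j = cubicTable j i := by decide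
  rw [cubicCoeff, cubicCoeff, this]

theorem cubicCoeff_rotate (i j k : Fin 6) : cubicCoeff i j k = cubicCoeff j k i := by
  have : ∀ i j k, cubicTable i j = some k ↔ cubicTable j k = some i := by decide
  simp only [cubicCoeff, this i j k]

/-- The part of degree two of the product of two linear forms. -/
noncomputable def cubicProduct (v w : Fin 6 → ℂ) (k : Fin 6) : ℂ :=
  ∑ i, ∑ j, cubicCoeff i j k * (v i * w j)

theorem cubicProduct_comm (v w : Fin 6 → ℂ) : cubicProduct v w = cubicProduct w v := by
  ext k
  rw [cubicProduct, Finset.sum_comm]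
  refine Finset.sum_congr rfl fun i _ => Finset.sum_congr rfl fun j _ => ?_
  rw [cubicCoeff_comm, mul_comm (v j)]

/-- Both sides are the polarised cubic form at `u, v, w`. This is associativity in degree three. -/
theorem sum_cubicProduct_mul (u v w : Fin 6 → ℂ) :
    ∑ k, cubicProduct u v k * w k = ∑ k, u k * cubicProduct v w k := by
  simp only [cubicProduct, Finset.sum_mul, Finset.mul_sum]
  rw [Finset.sum_comm]
  refine Finset.sum_congr rfl fun i _ => ?_
  rw [Finset.sum_comm]
  refine Finset.sum_congr rfl fun j _ => Finset.sum_congr rfl fun k _ => ?_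
  rw [cubicCoeff_rotate]
  ring

theorem cubicProduct_add (u v w : Fin 6 → ℂ) :
    cubicProduct u (v + w) = cubicProduct u v + cubicProduct u w := by
  ext k
  simp only [cubicProduct, Pi.add_apply, mul_add, Finset.sum_add_distrib]

theorem cubicProduct_smul (a : ℂ) (u v : Fin 6 → ℂ) :
    cubicProduct u (a • v) = a • cubicProduct u v := by
  ext k
  simp only [cubicProduct, Pi.smul_apply, smul_eq_mul, Finset.mul_sum]
  exact Finset.sum_congr rfl fun i _ => Finset.sum_congr rfl fun j _ => by ring

/-- The apolar algebra of the cubic form, by its homogeneous components. -/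
def CubicAlgebra : Type := ℂ × (Fin 6 → ℂ) × (Fin 6 → ℂ) × ℂ

namespace CubicAlgebra

noncomputable instance : AddCommGroup CubicAlgebra :=
  inferInstanceAs (AddCommGroup (ℂ × (Fin 6 → ℂ) × (Fin 6 → ℂ) × ℂ))

noncomputable instance : Module ℂ CubicAlgebra :=
  inferInstanceAs (Module ℂ (ℂ × (Fin 6 → ℂ) × (Fin 6 → ℂ) × ℂ))

instance : Module.Finite ℂ CubicAlgebra :=
  inferInstanceAs (Module.Finite ℂ (ℂ × (Fin 6 → ℂ) × (Fin 6 → ℂ) × ℂ))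

theorem finrank_eq : Module.finrank ℂ CubicAlgebra = 14 := by
  have : Module.finrank ℂ (ℂ × (Fin 6 → ℂ) × (Fin 6 → ℂ) × ℂ) = 14 := by simp
  exact this

@[ext]
theorem ext {x y : CubicAlgebra} (h0 : x.1 = y.1) (h1 : ∀ i, x.2.1 i = y.2.1 i)
    (h2 : ∀ i, x.2.2.1 i = y.2.2.1 i) (h3 : x.2.2.2 = y.2.2.2) : x = y :=
  Prod.ext h0 (Prod.ext (funext h1) (Prod.ext (funext h2) h3))

noncomputable instance : One CubicAlgebra := ⟨((1, 0, 0, 0) : ℂ × (Fin 6 → ℂ) × (Fin 6 → ℂ) × ℂ)⟩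

noncomputable instance : Mul CubicAlgebra :=
  ⟨fun x y => ((x.1 * y.1, x.1 • y.2.1 + y.1 • x.2.1,
    x.1 • y.2.2.1 + y.1 • x.2.2.1 + cubicProduct x.2.1 y.2.1,
    x.1 * y.2.2.2 + y.1 * x.2.2.2 + (∑ i, x.2.1 i * y.2.2.1 i + ∑ i, y.2.1 i * x.2.2.1 i)) :
    ℂ × (Fin 6 → ℂ) × (Fin 6 → ℂ) × ℂ)⟩

@[simp] theorem add_fst (x y : CubicAlgebra) : (x + y).1 = x.1 + y.1 := rfl
@[simp] theorem add_linear (x y : CubicAlgebra) : (x + y).2.1 = x.2.1 + y.2.1 := rfl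
@[simp] theorem add_quadratic (x y : CubicAlgebra) : (x + y).2.2.1 = x.2.2.1 + y.2.2.1 := rfl
@[simp] theorem add_cubic (x y : CubicAlgebra) : (x + y).2.2.2 = x.2.2.2 + y.2.2.2 := rfl
@[simp] theorem zero_fst : (0 : CubicAlgebra).1 = 0 := rfl
@[simp] theorem zero_linear : (0 : CubicAlgebra).2.1 = 0 := rfl
@[simp] theorem zero_quadratic : (0 : CubicAlgebra).2.2.1 = 0 := rfl
@[simp] theorem zero_cubic : (0 : CubicAlgebra).2.2.2 = 0 := rfl
@[simp] theorem smul_fst (a : ℂ) (x : CubicAlgebra) : (a • x).1 = a * x.1 := rfl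
@[simp] theorem smul_linear (a : ℂ) (x : CubicAlgebra) : (a • x).2.1 = a • x.2.1 := rfl
@[simp] theorem smul_quadratic (a : ℂ) (x : CubicAlgebra) :
    (a • x).2.2.1 = a • x.2.2.1 := rfl
@[simp] theorem smul_cubic (a : ℂ) (x : CubicAlgebra) : (a • x).2.2.2 = a * x.2.2.2 := rfl
@[simp] theorem one_fst : (1 : CubicAlgebra).1 = 1 := rfl
@[simp] theorem one_linear : (1 : CubicAlgebra).2.1 = 0 := rfl
@[simp] theorem one_quadratic : (1 : CubicAlgebra).2.2.1 = 0 := rfl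
@[simp] theorem one_cubic : (1 : CubicAlgebra).2.2.2 = 0 := rfl
@[simp] theorem mul_fst (x y : CubicAlgebra) : (x * y).1 = x.1 * y.1 := rfl
@[simp] theorem mul_linear (x y : CubicAlgebra) :
    (x * y).2.1 = x.1 • y.2.1 + y.1 • x.2.1 := rfl
@[simp] theorem mul_quadratic (x y : CubicAlgebra) :
    (x * y).2.2.1 = x.1 • y.2.2.1 + y.1 • x.2.2.1 + cubicProduct x.2.1 y.2.1 := rfl
@[simp] theorem mul_cubic (x y : CubicAlgebra) :
    (x * y).2.2.2 = x.1 * y.2.2.2 + y.1 * x.2.2.2 +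
      (∑ i, x.2.1 i * y.2.2.1 i + ∑ i, y.2.1 i * x.2.2.1 i) := rfl

protected theorem mul_comm (x y : CubicAlgebra) : x * y = y * x := by
  ext
  · simp [mul_comm]
  · simp [add_comm]
  · simp [cubicProduct_comm x.2.1, add_comm]
  · simp only [mul_cubic]
    ring

protected theorem mul_add (x y z : CubicAlgebra) : x * (y + z) = x * y + x * z := by
  ext
  · simp [mul_add]
  · simp only [mul_linear, add_linear, add_fst, Pi.add_apply, Pi.smul_apply, smul_eq_mul]
    ring
  · simp only [mul_quadratic, add_linear, add_quadratic, add_fst, Pi.add_apply, Pi.smul_apply,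
      smul_eq_mul, cubicProduct_add]
    ring
  · simp only [mul_cubic, add_linear, add_quadratic, add_cubic, add_fst, Pi.add_apply,
      mul_add, add_mul, Finset.sum_add_distrib]
    ring

protected theorem mul_smul (a : ℂ) (x y : CubicAlgebra) : x * (a • y) = a • (x * y) := by
  ext
  · simp only [mul_fst, smul_fst]
    ring
  · simp only [mul_linear, smul_linear, smul_fst, Pi.add_apply, Pi.smul_apply, smul_eq_mul]
    ring
  · simp only [mul_quadratic, smul_linear, smul_quadratic, smul_fst, Pi.add_apply, Pi.smul_apply,
      smul_eq_mul, cubicProduct_smul]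
    ring
  · simp only [mul_cubic, smul_linear, smul_quadratic, smul_cubic, smul_fst, Pi.smul_apply,
      smul_eq_mul, mul_add, Finset.mul_sum]
    simp only [mul_left_comm, mul_assoc]

protected theorem mul_assoc (x y z : CubicAlgebra) : x * y * z = x * (y * z) := by
  ext
  · simp [mul_assoc]
  · simp only [mul_linear, mul_fst, Pi.add_apply, Pi.smul_apply, smul_eq_mul]
    ring
  · simp only [mul_quadratic, mul_linear, mul_fst, Pi.add_apply, Pi.smul_apply, smul_eq_mul,
      cubicProduct_add, cubicProduct_smul, cubicProduct_comm _ z.2.1]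
    rw [cubicProduct_comm x.2.1]
    ring
  · have h1 := sum_cubicProduct_mul x.2.1 y.2.1 z.2.1
    simp only [mul_comm (cubicProduct x.2.1 y.2.1 _)] at h1
    simp only [mul_cubic, mul_quadratic, mul_linear, mul_fst, Pi.add_apply, Pi.smul_apply,
      smul_eq_mul, mul_add, add_mul, Finset.sum_add_distrib, h1, Finset.mul_sum]
    simp only [mul_left_comm, mul_assoc, mul_comm]
    ring

noncomputable instance : CommRing CubicAlgebra :=
  { (inferInstance : AddCommGroup CubicAlgebra) with
    mul_assoc := CubicAlgebra.mul_assoc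
    mul_comm := CubicAlgebra.mul_comm
    left_distrib := CubicAlgebra.mul_add
    right_distrib := fun x y z => by
      rw [CubicAlgebra.mul_comm, CubicAlgebra.mul_add, CubicAlgebra.mul_comm z,
        CubicAlgebra.mul_comm z]
    one_mul := fun x => by ext <;> simp [cubicProduct]
    mul_one := fun x => by ext <;> simp [cubicProduct]
    zero_mul := fun x => by ext <;> simp [cubicProduct]
    mul_zero := fun x => by ext <;> simp [cubicProduct] }

noncomputable instance : Algebra ℂ CubicAlgebra :=
  Algebra.ofModule
    (fun a x y => by rw [mul_comm, CubicAlgebra.mul_smul, mul_comm])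
    (fun a x y => CubicAlgebra.mul_smul a x y)

/-- The generators of degree one. -/
noncomputable def X (i : Fin 6) : CubicAlgebra :=
  ((0, Pi.single i 1, 0, 0) : ℂ × (Fin 6 → ℂ) × (Fin 6 → ℂ) × ℂ)

/-- The basis of the part of degree two that is dual to the generators. -/
noncomputable def Y (i : Fin 6) : CubicAlgebra :=
  ((0, 0, Pi.single i 1, 0) : ℂ × (Fin 6 → ℂ) × (Fin 6 → ℂ) × ℂ)

/-- The socle generator. -/
noncomputable def W : CubicAlgebra := ((0, 0, 0, 1) : ℂ × (Fin 6 → ℂ) × (Fin 6 → ℂ) × ℂ)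

@[simp] theorem X_fst (i : Fin 6) : (X i).1 = 0 := rfl
@[simp] theorem X_linear (i : Fin 6) : (X i).2.1 = Pi.single i 1 := rfl
@[simp] theorem X_quadratic (i : Fin 6) : (X i).2.2.1 = 0 := rfl
@[simp] theorem X_cubic (i : Fin 6) : (X i).2.2.2 = 0 := rfl
@[simp] theorem Y_fst (i : Fin 6) : (Y i).1 = 0 := rfl
@[simp] theorem Y_linear (i : Fin 6) : (Y i).2.1 = 0 := rfl
@[simp] theorem Y_quadratic (i : Fin 6) : (Y i).2.2.1 = Pi.single i 1 := rfl
@[simp] theorem Y_cubic (i : Fin 6) : (Y i).2.2.2 = 0 := rfl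
@[simp] theorem W_fst : W.1 = 0 := rfl
@[simp] theorem W_linear : W.2.1 = 0 := rfl
@[simp] theorem W_quadratic : W.2.2.1 = 0 := rfl
@[simp] theorem W_cubic : W.2.2.2 = 1 := rfl

theorem cubicProduct_zero (v : Fin 6 → ℂ) : cubicProduct v 0 = 0 := by
  ext
  simp [cubicProduct]

theorem cubicProduct_single (i j k : Fin 6) :
    cubicProduct (Pi.single i 1) (Pi.single j 1) k = cubicCoeff i j k := by
  rw [cubicProduct, Finset.sum_eq_single i, Finset.sum_eq_single j]
  all_goals simp +contextual

theorem X_mul_X (i j : Fin 6) : X i * X j = (cubicTable i j).elim 0 Y := by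
  rcases h : cubicTable i j with _ | k
  · ext <;> simp [cubicProduct_single, cubicCoeff, h]
  · ext <;> simp [cubicProduct_single, cubicCoeff, h, Pi.single_apply, eq_comm]

theorem X_mul_Y (i j : Fin 6) : X i * Y j = if j = i then W else 0 := by
  split_ifs with h
  · subst h
    ext <;> simp [cubicProduct_zero, Pi.single_apply]
  · ext <;> simp [cubicProduct_zero, Pi.single_apply, h]

theorem Y_mul_Y (i j : Fin 6) : Y i * Y j = 0 := by
  ext <;> simp [cubicProduct_zero]

theorem X_mul_W (i : Fin 6) : X i * W = 0 := by
  ext <;> simp [cubicProduct_zero]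

theorem Y_mul_W (i : Fin 6) : Y i * W = 0 := by
  ext <;> simp [cubicProduct_zero]

theorem W_mul_W : W * W = 0 := by
  ext <;> simp [cubicProduct_zero]

theorem linearMap_eq_zero {M : Type} [AddCommMonoid M] [Module ℂ M] {f : CubicAlgebra →ₗ[ℂ] M}
    (h1 : f 1 = 0) (hX : ∀ i, f (X i) = 0) (hY : ∀ i, f (Y i) = 0) (hW : f W = 0) : f = 0 := by
  refine LinearMap.ext fun x => ?_
  have hx : x = x.1 • 1 + ∑ i, x.2.1 i • X i + ∑ i, x.2.2.1 i • Y i + x.2.2.2 • W := by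
    rw [Fin.sum_univ_six, Fin.sum_univ_six]
    ext i
    · simp
    · fin_cases i <;> simp
    · fin_cases i <;> simp
    · simp
  rw [hx]
  simp [h1, hX, hY, hW]

/-- The functional on the algebra that reads off the socle component. -/
noncomputable def socle : CubicAlgebra →ₗ[ℂ] ℂ where
  toFun x := x.2.2.2
  map_add' _ _ := rfl
  map_smul' _ _ := rfl

/-- The product pairs degree zero with degree three and degree one with degree two perfectly. -/
theorem socle_nondegenerate (x : CubicAlgebra) (h : ∀ y, socle (x * y) = 0) : x = 0 := by
  have hs : ∀ y : CubicAlgebra, socle y = y.2.2.2 := fun _ => rfl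
  simp only [hs] at h
  ext i
  · simpa using h W
  · simpa [Pi.single_apply] using h (Y i)
  · simpa [Pi.single_apply] using h (X i)
  · simpa using h 1

end CubicAlgebra

namespace CubicAlgebra

/-! ### The annihilator of alternants of the algebra -/

/-- The ordered triples of elements of `Fin 6`. -/
abbrev OrderedTriple : Type := {t : Fin 6 × Fin 6 × Fin 6 // t.1 ≤ t.2.1 ∧ t.2.1 ≤ t.2.2}

theorem card_orderedTriple : Fintype.card OrderedTriple = 56 := by decide +kernel

set_option linter.unusedSimpArgs false in
/-- A symmetric trilinear form that satisfies the relations of the annihilator of alternants and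
vanishes if one of its arguments is `1` is determined by few of its values. -/
theorem symmetric_eq_zero {H : CubicAlgebra →ₗ[ℂ] CubicAlgebra →ₗ[ℂ] CubicAlgebra →ₗ[ℂ] ℂ}
    (h1 : ∀ y z, H 1 y z = 0) (hs : ∀ x y z, H x y z = H y x z) (ht : ∀ x y z, H x y z = H x z y)
    (hr : ∀ x y z w, H x w (y * z) + H y z (x * w) = H x z (y * w) + H y w (x * z))
    (h3 : ∀ t : OrderedTriple, H (X t.1.1) (X t.1.2.1) (X t.1.2.2) = 0)
    (h4 : ∀ p ∈ quarticPositions, H (X p.1) (X p.2.1) (Y p.2.2) = 0)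
    (h5 : ∀ p ∈ quinticPositions, H (X p.1) (Y p.2.1) (Y p.2.2) = 0) : H = 0 := by
  have hXY : ∀ i, X i * Y i = W := fun i => by rw [X_mul_Y, if_pos rfl]
  have hXY' : ∀ i j, j ≠ i → X i * Y j = 0 := fun i j h => by rw [X_mul_Y, if_neg h]
  have hYX : ∀ i j, Y i * X j = X j * Y i := fun i j => mul_comm _ _
  have hWY : ∀ i, W * Y i = 0 := fun i => by rw [mul_comm, Y_mul_W]
  -- Degrees six and higher, type by type. In most of these relations a product `X p * Y p = W`
  -- produces the wanted value, and `p` is chosen so that the other products vanish.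
  have YYW : ∀ i j, H (Y i) (Y j) W = 0 := fun i j => by
    obtain ⟨p, hp⟩ := exists_ne j
    simpa [hXY, hXY' p j hp.symm, Y_mul_Y] using hr (X p) (Y i) (Y j) (Y p)
  have YWW : ∀ i, H (Y i) W W = 0 := fun i => by
    simpa [hXY, Y_mul_Y, X_mul_W, Y_mul_W] using hr (X 0) (Y i) W (Y 0)
  have WWW : H W W W = 0 := by
    simpa [hXY, hWY, X_mul_W, W_mul_W] using hr (X 0) W W (Y 0)
  have XWW : ∀ i, H (X i) W W = 0 := fun i => by
    obtain ⟨p, hp⟩ := exists_ne i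
    simpa [hXY, hXY' i p hp, X_mul_W] using hr (X p) (X i) W (Y p)
  have XYW : ∀ i j, H (X i) (Y j) W = 0 := by
    intro i j
    by_cases hij : j = i
    · subst hij
      -- On the diagonal a relation only gives the sum of two values; three distinct indices then
      -- force each value to be zero.
      have hsum : ∀ p q, p ≠ q → H (X p) (Y p) W + H (X q) (Y q) W = 0 := fun p q hpq => by
        simpa [hXY, hXY' p q hpq.symm, hXY' q p hpq] using hr (X p) (X q) (Y q) (Y p)
      have hne : ∀ j : Fin 6, j ≠ j + 1 ∧ j ≠ j + 2 ∧ j + 1 ≠ j + 2 := by decide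
      have e1 := hsum j (j + 1) (hne j).1
      have e2 := hsum j (j + 2) (hne j).2.1
      have e3 := hsum (j + 1) (j + 2) (hne j).2.2
      linear_combination (e1 + e2 - e3) / 2
    · obtain ⟨p, hpi, hpj⟩ : ∃ p, p ≠ i ∧ p ≠ j := by
        clear hij
        revert i j
        decide
      simpa [hXY, hXY' i j hij, hXY' i p hpi, hXY' p j hpj.symm] using
        hr (X p) (X i) (Y j) (Y p)
  have XYW' : ∀ i j (p : Prop) [Decidable p], H (X i) (Y j) (if p then W else 0) = 0 := by
    intro i j p _
    split_ifs
    · exact XYW i j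
    · exact map_zero _
  -- Every `Y k` is a product of two generators, which leads back to values at `X`, `Y`, `W`.
  have YYY : ∀ i j k, H (Y i) (Y j) (Y k) = 0 := by
    intro i j k
    obtain ⟨a, b, hab⟩ : ∃ a b, cubicTable a b = some k := by
      revert k
      decide
    have := hr (X a) (Y i) (Y j) (X b)
    rw [Y_mul_Y, map_zero, X_mul_X, hab, hYX, X_mul_Y, X_mul_Y, hs (Y i) (X b), XYW', XYW'] at this
    simpa using this
  have helim : ∀ x y (o : Option (Fin 6)), H x y (o.elim 0 Y) = o.elim 0 fun k => H x y (Y k) := by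
    rintro x y (_ | k)
    · exact map_zero _
    · rfl
  have hite : ∀ x y (p : Prop) [Decidable p], H x y (if p then W else 0) =
      if p then H x y W else 0 := by
    intro x y p _
    split_ifs
    · rfl
    · exact map_zero _
  have hquintic := quintic_eq_zero (fun a b => H (X a) (X b) W) (fun c i j => H (X c) (Y i) (Y j))
    (fun i j => hs _ _ _) (fun c i j => ht _ _ _)
    (fun a b c q => by
      have := hr (X a) (X c) (Y q) (X b)
      rw [X_mul_Y, X_mul_X, X_mul_X, X_mul_Y, helim, helim, hite, hite] at this
      linear_combination this) h5
  have XXY : ∀ i j k, H (X i) (X j) (Y k) = 0 :=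
    quartic_eq_zero (fun i j k => H (X i) (X j) (Y k)) (fun i j k => hs _ _ _)
      (fun i j k l => by
        have := hr (X i) (X l) (X k) (X j)
        rwa [hs (X l), hs (X l), mul_comm (X l), mul_comm (X l), X_mul_X, X_mul_X, X_mul_X,
          X_mul_X, helim, helim, helim, helim] at this) h4
  have XXX : ∀ i j k, H (X i) (X j) (X k) = 0 := by
    have hle : ∀ i j k, i ≤ j → j ≤ k → H (X i) (X j) (X k) = 0 := fun i j k hij hjk =>
      h3 ⟨(i, j, k), hij, hjk⟩
    intro i j k
    rcases le_total i j with hij | hij <;> rcases le_total j k with hjk | hjk <;>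
      rcases le_total i k with hik | hik
    · exact hle _ _ _ hij hjk
    · exact hle _ _ _ hij hjk
    · rw [ht]; exact hle _ _ _ hik hjk
    · rw [ht, hs]; exact hle _ _ _ hik hij
    · rw [hs]; exact hle _ _ _ hij hik
    · rw [hs, ht]; exact hle _ _ _ hjk hik
    · rw [hs, ht, hs]; exact hle _ _ _ hjk hij
    · rw [hs, ht, hs]; exact hle _ _ _ hjk hij
  have h1' : ∀ x z, H x 1 z = 0 := fun x z => by rw [hs, h1]
  have h1'' : ∀ x y, H x y 1 = 0 := fun x y => by rw [ht, h1']
  refine linearMap_eq_zero ?_ (fun i => ?_) (fun i => ?_) ?_ <;>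
  refine linearMap_eq_zero ?_ (fun j => ?_) (fun j => ?_) ?_ <;>
  refine linearMap_eq_zero ?_ (fun k => ?_) (fun k => ?_) ?_
  all_goals
    first
    | exact h1 _ _
    | exact h1' _ _
    | exact h1'' _ _
    | simp only [XXX, XXY, hquintic.1, hquintic.2, XYW, XWW, YYY, YYW, YWW, WWW]
    | (rw [hs]; simp only [XXX, XXY, hquintic.1, hquintic.2, XYW, XWW, YYY, YYW, YWW, WWW])
    | (rw [ht]; simp only [XXX, XXY, hquintic.1, hquintic.2, XYW, XWW, YYY, YYW, YWW, WWW])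
    | (rw [hs, ht]; simp only [XXX, XXY, hquintic.1, hquintic.2, XYW, XWW, YYY, YYW, YWW, WWW])
    | (rw [ht, hs]; simp only [XXX, XXY, hquintic.1, hquintic.2, XYW, XWW, YYY, YYW, YWW, WWW])
    | (rw [hs, ht, hs]; simp only [XXX, XXY, hquintic.1, hquintic.2, XYW, XWW, YYY, YYW, YWW, WWW])

/-! ### Reduction to symmetric forms and the count of determining values -/

/-- The basis of the maximal ideal. -/
noncomputable def maximalBasis : Fin 6 ⊕ Fin 6 ⊕ Unit → CubicAlgebra :=
  Sum.elim X (Sum.elim Y fun _ => W)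

/-- The basis of the algebra; `none` stands for `1`. -/
noncomputable def fullBasis (o : Option (Fin 6 ⊕ Fin 6 ⊕ Unit)) : CubicAlgebra :=
  o.elim 1 maximalBasis

theorem linearMap_eq_zero' {M : Type} [AddCommMonoid M] [Module ℂ M] {f : CubicAlgebra →ₗ[ℂ] M}
    (h : ∀ o, f (fullBasis o) = 0) : f = 0 :=
  linearMap_eq_zero (h none) (fun i => h (some (Sum.inl i)))
    (fun i => h (some (Sum.inr (Sum.inl i)))) (h (some (Sum.inr (Sum.inr ()))))

/-- The indices of the values that determine a form in the annihilator of alternants. -/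
abbrev DeterminingIndex : Type :=
  (Option (Fin 6 ⊕ Fin 6 ⊕ Unit) × Option (Fin 6 ⊕ Fin 6 ⊕ Unit)) ⊕
    ((Fin 6 ⊕ Fin 6 ⊕ Unit) × Option (Fin 6 ⊕ Fin 6 ⊕ Unit)) ⊕ Sym2 (Fin 6 ⊕ Fin 6 ⊕ Unit) ⊕
    OrderedTriple ⊕ Fin quarticPositions.length ⊕ Fin quinticPositions.length

/-- The arguments at which a form in the annihilator of alternants is evaluated in order to
determine it. -/
noncomputable def determiningArguments :
    DeterminingIndex → CubicAlgebra × CubicAlgebra × CubicAlgebra :=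
  Sum.elim (fun p => (1, fullBasis p.1, fullBasis p.2)) <|
    Sum.elim (fun p => (maximalBasis p.1, 1, fullBasis p.2)) <|
    Sum.elim (fun s => (maximalBasis (Quot.out s).1, maximalBasis (Quot.out s).2, 1)) <|
    Sum.elim (fun t => (X t.1.1, X t.1.2.1, X t.1.2.2)) <|
    Sum.elim (fun t => (X (quarticPositions.get t).1, X (quarticPositions.get t).2.1,
      Y (quarticPositions.get t).2.2))
    (fun t => (X (quinticPositions.get t).1, Y (quinticPositions.get t).2.1,
      Y (quinticPositions.get t).2.2))

/-- The summands are `196 + 182 + 91 + 56 + 27 + 6`. -/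
theorem card_determiningIndex : Fintype.card DeterminingIndex = 558 := by
  simp only [Fintype.card_sum, Fintype.card_prod, Fintype.card_option, Fintype.card_fin,
    Fintype.card_unit, Sym2.card, card_orderedTriple]
  rfl

/-- Once all values with an argument `1` vanish, the relations with `1` among the alternated
elements show that `G` is symmetric, and they become the four-term relations of `symmetric_eq_zero`.
-/
theorem eq_zero_of_determiningArguments
    {G : CubicAlgebra →ₗ[ℂ] CubicAlgebra →ₗ[ℂ] CubicAlgebra →ₗ[ℂ] ℂ}
    (hG : G ∈ alternantAnnihilator CubicAlgebra)
    (h : ∀ k, G (determiningArguments k).1 (determiningArguments k).2.1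
      (determiningArguments k).2.2 = 0) : G = 0 := by
  have h1 : ∀ y z, G 1 y z = 0 := by
    have : G 1 = 0 := linearMap_eq_zero' fun i => linearMap_eq_zero' fun j => h (Sum.inl (i, j))
    intro y z
    rw [this]
    rfl
  have h2 : ∀ x z, G x 1 z = 0 := by
    have : G.flip 1 = 0 := by
      refine linearMap_eq_zero' fun i => linearMap_eq_zero' fun j => ?_
      rcases i with _ | i
      · exact h1 _ _
      · exact h (Sum.inr (Sum.inl (i, j)))
    intro x z
    exact DFunLike.congr_fun (DFunLike.congr_fun this x) z
  have h3 : ∀ x y, G x y 1 = 0 := by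
    -- This symmetry is why unordered pairs suffice when the third argument is `1`.
    have hsymm : ∀ x y, G x y 1 = G y x 1 := fun x y => by
      have := hG 1 x y 1 1
      simp only [antisymmetrizedValue, mul_one, h1, h2] at this
      linear_combination this
    have : (LinearMap.applyₗ (1 : CubicAlgebra) : _ →ₗ[ℂ] ℂ).compRight ℂ ∘ₗ G = 0 := by
      refine linearMap_eq_zero' fun i => linearMap_eq_zero' fun j => ?_
      change G (fullBasis i) (fullBasis j) 1 = 0
      rcases i with _ | i
      · exact h1 _ _
      rcases j with _ | j
      · exact h2 _ _
      have hs := h (Sum.inr (Sum.inr (Sum.inl s(i, j))))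
      change G (maximalBasis (Quot.out s(i, j)).1) (maximalBasis (Quot.out s(i, j)).2) 1 = 0 at hs
      change G (maximalBasis i) (maximalBasis j) 1 = 0
      have hout : s((Quot.out s(i, j)).1, (Quot.out s(i, j)).2) = s(i, j) := Quot.out_eq s(i, j)
      rcases Sym2.eq_iff.1 hout with ⟨e1, e2⟩ | ⟨e1, e2⟩
      · rwa [e1, e2] at hs
      · rw [e1, e2] at hs
        rwa [hsymm]
    intro x y
    exact DFunLike.congr_fun (DFunLike.congr_fun this x) y
  have hs : ∀ x y z, G x y z = G y x z := fun x y z => by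
    have := hG 1 x y 1 z
    simp only [antisymmetrizedValue, mul_one, one_mul, h1, h2] at this
    linear_combination this
  have ht : ∀ x y z, G x y z = G x z y := fun x y z => by
    have := hG 1 y z x 1
    simp only [antisymmetrizedValue, mul_one, one_mul, h1, h3] at this
    rw [hs x y, hs x z]
    linear_combination -this
  refine symmetric_eq_zero h1 hs ht (fun x y z w => ?_)
    (fun t => h (Sum.inr (Sum.inr (Sum.inr (Sum.inl t))))) (fun p hp => ?_) (fun p hp => ?_)
  · have := hG 1 x y z w
    simp only [antisymmetrizedValue, one_mul, h1] at this
    rw [ht x w, ht y w]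
    linear_combination this
  · obtain ⟨t, rfl⟩ := List.mem_iff_get.1 hp
    exact h (Sum.inr (Sum.inr (Sum.inr (Sum.inr (Sum.inl t)))))
  · obtain ⟨t, rfl⟩ := List.mem_iff_get.1 hp
    exact h (Sum.inr (Sum.inr (Sum.inr (Sum.inr (Sum.inr t)))))

end CubicAlgebra

/-! ### Frobenius algebras in all dimensions from fourteen on, and the conclusion -/

theorem existsFrobeniusAlgebra_fourteen : ExistsFrobeniusAlgebra 14 := by
  refine ⟨CubicAlgebra, inferInstance, inferInstance, CubicAlgebra.socle, inferInstance,
    CubicAlgebra.finrank_eq, CubicAlgebra.socle_nondegenerate, ?_⟩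
  have := finrank_le_card_of_forall_eval (alternantAnnihilator CubicAlgebra)
    CubicAlgebra.determiningArguments fun G hG => CubicAlgebra.eq_zero_of_determiningArguments hG
  rw [CubicAlgebra.card_determiningIndex] at this
  -- The margin is one: `558 + 28 + 1 = 587` and `3 * 14 ^ 2 = 588`.
  omega

theorem existsFrobeniusAlgebra_of_le {n : ℕ} (hn : 14 ≤ n) : ExistsFrobeniusAlgebra n :=
  Nat.le_induction existsFrobeniusAlgebra_fourteen (fun _ _ => ExistsFrobeniusAlgebra.succ) n hn

theorem exists_not_vanishesOn_cactusVariety {n : ℕ} (hn : 14 ≤ n) (i : Fin 3) :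
    ∃ (r : Fin (n * (n - 1) * (n - 2) + 1) ↪ TensorIndex n)
      (c : Fin (n * (n - 1) * (n - 2) + 1) ↪ WedgeIndex n),
      ¬ VanishesOn (tangencyMinor i r c) (cactusVariety n (segreVariety n)) := by
  obtain ⟨R, _, _, φ, _, hR, hφ, hK⟩ := existsFrobeniusAlgebra_of_le hn
  let b := Module.finBasisOfFinrankEq ℂ R hR
  have hrank : n * (n - 1) * (n - 2) + 1 ≤ (tangencyMatrix (traceTensor b φ)).rank := by
    have h := pow_three_le_rank_add_finrank b hφ
    -- Writing `n = 14 + m` makes the subtractions exact; the claim is then `n³ - (3 n² - 2 n - 1) =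
    -- n (n - 1) (n - 2) + 1`.
    obtain ⟨m, rfl⟩ := Nat.exists_eq_add_of_le hn
    have e1 : 14 + m - 1 = 13 + m := by omega
    have e2 : 14 + m - 2 = 12 + m := by omega
    rw [e1, e2]
    nlinarith
  obtain ⟨r, c, hrc⟩ := Matrix.exists_det_submatrix_ne_zero _ hrank
  refine ⟨r, c, fun h => hrc ?_⟩
  have hne : traceTensor b φ ≠ 0 := by
    intro h0
    have : tangencyMatrix (traceTensor b φ) = 0 := by
      ext ⟨a, b, c⟩ ⟨s, b', c'⟩
      simp [tangencyMatrix, h0]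
    rw [this, Matrix.rank_zero] at hrank
    omega
  have := h _ hne (mk_traceTensor_mem_cactusVariety b ⟨0, by omega⟩ φ hne)
  rwa [eval_tangencyMinor, tangencyFlattening, moveToFront_traceTensor] at this

theorem theorem1p1 (n : ℕ) (hn : 14 ≤ n) (i : Fin 3) :
    (∀ (r : Fin (n * (n - 1) * (n - 2) + 1) ↪ TensorIndex n)
        (c : Fin (n * (n - 1) * (n - 2) + 1) ↪ WedgeIndex n),
        VanishesOn (tangencyMinor i r c) (secantVariety n (segreVariety n))) ∧
      ∃ (r : Fin (n * (n - 1) * (n - 2) + 1) ↪ TensorIndex n)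
        (c : Fin (n * (n - 1) * (n - 2) + 1) ↪ WedgeIndex n),
        ¬ VanishesOn (tangencyMinor i r c) (cactusVariety n (segreVariety n)) :=
  ⟨vanishesOn_secantVariety i, exists_not_vanishesOn_cactusVariety hn i⟩
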